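/- Let $X$ be a deterministic real $n\times d$ matrix without zero columns, let $\beta_\star\in\mathbb R^d$, and let $Y = X\beta_\star+\varepsilon$, where the random vector $\varepsilon$ satisfies $\mathbb E[\varepsilon]=0$ and $\mathrm{Cov}(\varepsilon)=I_n$. Write $\mathbb X := X^\top X$ and, for $p\in(0,1)$, $\mathbb X_p := p\,\mathbb X+(1-p)\,\mathrm{Diag}(\mathbb X)$, where $\mathrm{Diag}(A)$ is the diagonal matrix with the same diagonal as $A$. Let $\|\cdot\|$ be the spectral norm and $\lambda_{\min}$ the smallest eigenvalue of a symmetric matrix; for symmetric matrices, $A\ge B$ means that $A-B$ is positive semi-definite. A $p$-dropout matrix is a random diagonal $d\times d$ matrix whose diagonal entries are i.i.d. $\mathrm{Ber}(p)$. Let $D_1,D_2,\dots$ be i.i.d. $p$-dropout matrices, let $\tilde\beta_0$ be a square integrable random vector in $\mathbb R^d$ that is independent of $Y$, and suppose that the sequence $(D_k)_{k\ge1}$ is independent of $(\tilde\beta_0,Y)$. For a learning rate $\alpha>0$, the iterates of gradient descent with dropout are $$\tilde\beta_{k+1} = \tilde\beta_k+\alpha D_{k+1}X^\top\bigl(Y-XD_{k+1}\tilde\beta_k\bigr),\qquad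 k=0,1,2,\dots$$ Let $\tilde\beta := \operatorname{argmin}_{\beta\in\mathbb R^d}\mathbb E\bigl[\|Y-XD\beta\|_2^2\mid Y\bigr]$ be the minimizer of the marginalized loss, where $D$ is a $p$-dropout matrix independent of $Y$. Assume that $$\alpha p\|\mathbb X\|<1,\qquad \alpha<\frac{\lambda_{\min}(\mathbb X_p)}{3\|\mathbb X\|^2},$$ and that for every $\ell=1,\dots,d$ there is some $m\ne\ell$ with $\mathbb X_{\ell m}\neq0$. Then the limit $\lim_{k\to\infty}\mathrm{Cov}(\tilde\beta_k)$ exists and $$\lim_{k\to\infty}\mathrm{Cov}(\tilde\beta_k)-\mathrm{Cov}(\tilde\beta)\;\ge\;\frac{\alpha p(1-p)^2\lambda_{\min}(\mathbb X)}{2\|\mathbb X\|^3}\,\min_{i\ne j:\,\mathbb X_{ij}\ne0}\mathbb X_{ij}^2\cdot I_d .$$ -/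

import Mathlib

open MeasureTheory ProbabilityTheory Filter Topology
open scoped Matrix

namespace Dropout

noncomputable section

/-- The Gram matrix `𝕏 = Xᵀ X` of a design matrix. -/
def gram {n d : ℕ} (X : Matrix (Fin n) (Fin d) ℝ) : Matrix (Fin d) (Fin d) ℝ := Xᵀ * X

/-- `A_p = p A + (1 - p) Diag(A)`. -/
def shrink {d : ℕ} (p : ℝ) (A : Matrix (Fin d) (Fin d) ℝ) : Matrix (Fin d) (Fin d) ℝ :=
  p • A + (1 - p) • Matrix.diagonal A.diag

/-- The spectral norm: the operator norm induced by the Euclidean norm. -/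
def spectralNorm {d : ℕ} (A : Matrix (Fin d) (Fin d) ℝ) : ℝ :=
  ‖Matrix.toEuclideanCLM (n := Fin d) (𝕜 := ℝ) A‖

/-- The smallest eigenvalue; only used for symmetric matrices, whose spectrum is real, finite,
and nonempty unless `d = 0`. -/
def lambdaMin {d : ℕ} (A : Matrix (Fin d) (Fin d) ℝ) : ℝ := sInf (spectrum ℝ A)

/-- `min_{i ≠ j, A_ij ≠ 0} A_ij²`. -/
def minOffDiagSq {d : ℕ} (A : Matrix (Fin d) (Fin d) ℝ) : ℝ :=
  sInf {x | ∃ i j, i ≠ j ∧ A i j ≠ 0 ∧ x = A i j ^ 2}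

/-- The covariance matrix of a random vector. -/
def covMat {Ω : Type*} [MeasurableSpace Ω] {m : ℕ} (Z : Ω → Fin m → ℝ) (P : Measure Ω) :
    Matrix (Fin m) (Fin m) ℝ :=
  Matrix.of fun i j => covariance (fun ω => Z ω i) (fun ω => Z ω j) P

/-- The law of the diagonal of a `p`-dropout matrix: `d` i.i.d. entries, equal to `1` with
probability `p` and to `0` with probability `1 - p`. -/
def dropoutLaw (d : ℕ) (p : unitInterval) : Measure (Fin d → ℝ) :=
  Measure.pi fun _ => bernoulliMeasure (1 : ℝ) 0 p

/-- The dropout gradient descent iterates, with learning rate `α`, response `y`, start `b₀` and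
step `b ↦ b + α D Xᵀ (y - X D b)`. Here `δ k` is the diagonal of the dropout matrix `D_{k+1}`
used to pass from the `k`-th to the `(k+1)`-st iterate. -/
def iterate {n d : ℕ} (X : Matrix (Fin n) (Fin d) ℝ) (α : ℝ) (y : Fin n → ℝ) (b₀ : Fin d → ℝ)
    (δ : ℕ → Fin d → ℝ) : ℕ → Fin d → ℝ
  | 0 => b₀
  | k + 1 =>
    iterate X α y b₀ δ k +
      α • (Matrix.diagonal (δ k) *ᵥ
        (Xᵀ *ᵥ (y - X *ᵥ (Matrix.diagonal (δ k) *ᵥ iterate X α y b₀ δ k))))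

/-- The marginalized loss `b ↦ E[‖Y - X D b‖₂² | Y = y]`, where the dropout matrix `D` is
independent of `Y`. -/
def marginalLoss {n d : ℕ} (X : Matrix (Fin n) (Fin d) ℝ) (p : unitInterval) (y : Fin n → ℝ)
    (b : Fin d → ℝ) : ℝ :=
  ∫ δ, (∑ i, (y i - (X *ᵥ (Matrix.diagonal δ *ᵥ b)) i) ^ 2) ∂(dropoutLaw d p)

/-- The minimizer of the marginalized loss. If `X` has no zero column and `0 < p < 1`, then the
loss is a strictly convex quadratic function of `b`, so there is exactly one minimizer. -/
def marginalMinimizer {n d : ℕ} (X : Matrix (Fin n) (Fin d) ℝ) (p : unitInterval)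
    (y : Fin n → ℝ) : Fin d → ℝ :=
  Classical.epsilon fun b => ∀ b', marginalLoss X p y b ≤ marginalLoss X p y b'

end

end Dropout

namespace Dropout

noncomputable section

/-! ### Quadratic forms, the spectral norm and the smallest eigenvalue -/

section LinearAlgebra

variable {d : ℕ}

/-! Write `A` for the Gram matrix, `A_p` for its shrunk version and `b` for the minimizer of the
marginalized loss. The normal equation `A_p b = Xᵀ Y` (`marginalMinimizer_eq`) turns a dropout step
into an affine recursion for the error `e = β̃ - b`: `e' = Q e + R b` with `Q = 1 - α D A D` and `R
= α (D A_p - D A D)` (`iterate_succ_sub`). Here `D` is independent of `(e, b)`, and `𝔼[R] = 0`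
because `D A_p` and `D A D` both have mean `p A_p`.

Convergence. Since `R` is centred, `𝔼[e bᵀ]` and `𝔼[e]` are multiplied by `1 - α p A_p` at each step
and decay to zero. The second moment of `e` obeys `M' = 𝔼[Q M Qᵀ] + 𝔼[R S Rᵀ]` plus terms linear in
`𝔼[e bᵀ]`, where `S = 𝔼[b bᵀ]`. The learning rate condition gives `𝔼[Q²] ≤ r² I` with `r < 1`
(`sum_weight_mul_stepMatrix_le`), so by Cauchy-Schwarz the linear part contracts the spectral norm.
The second moments therefore converge to a fixed point `M = 𝔼[Q M Qᵀ] + 𝔼[R S Rᵀ]`. As means and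
cross terms vanish in the limit, `Cov(β̃_k)` tends to `M + Cov(b)`, and the gap to be bounded is
exactly `M` (`exists_tendsto_covMat`).

Lower bound. Three estimates enter: `S ≥ λ_min(A) ‖A‖⁻² I` (`le_crossMoment_minimizer`), `𝔼[R Rᵀ] ≥
α² p² (1 - p)² min A_ij² I` (`le_sum_weight_mul_noiseMatrix`), and `𝔼[Q²] ≥ (1 - 2 α p ‖A‖) I`
(`le_sum_weight_mul_stepMatrix`). Iterating the fixed point equation from `M ≥ 0` sums a geometric
series, which divides the product of the first two constants by `2 α p ‖A‖`
(`le_dotProduct_mulVec_of_fixedPoint`). -/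

lemma norm_toLp_sq (v : Fin d → ℝ) : ‖WithLp.toLp 2 v‖ ^ 2 = v ⬝ᵥ v := by
  rw [EuclideanSpace.norm_sq_eq]
  simp [dotProduct, sq]

lemma dotProduct_self_nonneg_real (v : Fin d → ℝ) : 0 ≤ v ⬝ᵥ v := by
  rw [← norm_toLp_sq]; positivity

lemma spectralNorm_nonneg (A : Matrix (Fin d) (Fin d) ℝ) : 0 ≤ spectralNorm A := norm_nonneg _

lemma norm_toLp_mulVec_le (A : Matrix (Fin d) (Fin d) ℝ) (v : Fin d → ℝ) :
    ‖WithLp.toLp 2 (A *ᵥ v)‖ ≤ spectralNorm A * ‖WithLp.toLp 2 v‖ :=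
  (Matrix.toEuclideanCLM (n := Fin d) (𝕜 := ℝ) A).le_opNorm (WithLp.toLp 2 v)

lemma mulVec_dotProduct_self_le (A : Matrix (Fin d) (Fin d) ℝ) (v : Fin d → ℝ) :
    (A *ᵥ v) ⬝ᵥ (A *ᵥ v) ≤ spectralNorm A ^ 2 * (v ⬝ᵥ v) := by
  rw [← norm_toLp_sq, ← norm_toLp_sq, ← mul_pow]
  gcongr
  exact norm_toLp_mulVec_le A v

lemma dotProduct_le_norm_mul_norm (u v : Fin d → ℝ) :
    u ⬝ᵥ v ≤ ‖WithLp.toLp 2 u‖ * ‖WithLp.toLp 2 v‖ := by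
  have h := real_inner_le_norm (WithLp.toLp 2 v) (WithLp.toLp 2 u)
  rw [EuclideanSpace.inner_eq_star_dotProduct] at h
  simpa [mul_comm] using h

lemma dotProduct_mulVec_le (A : Matrix (Fin d) (Fin d) ℝ) (v : Fin d → ℝ) :
    v ⬝ᵥ (A *ᵥ v) ≤ spectralNorm A * (v ⬝ᵥ v) := by
  calc v ⬝ᵥ (A *ᵥ v) ≤ ‖WithLp.toLp 2 v‖ * ‖WithLp.toLp 2 (A *ᵥ v)‖ :=
        dotProduct_le_norm_mul_norm _ _
    _ ≤ ‖WithLp.toLp 2 v‖ * (spectralNorm A * ‖WithLp.toLp 2 v‖) := by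
        gcongr; exact norm_toLp_mulVec_le A v
    _ = _ := by rw [← norm_toLp_sq]; ring

/-- Subtracting `lambdaMin A` shifts the spectrum into `[0, ∞)`, which for a Hermitian matrix means
positive semidefinite. -/
lemma lambdaMin_mul_le {A : Matrix (Fin d) (Fin d) ℝ} (hA : A.IsHermitian) (v : Fin d → ℝ) :
    lambdaMin A * (v ⬝ᵥ v) ≤ v ⬝ᵥ (A *ᵥ v) := by
  have hbdd : BddBelow (spectrum ℝ A) := by
    rw [hA.spectrum_real_eq_range_eigenvalues]
    exact (Set.finite_range _).bddBelow
  have hps : (A - algebraMap ℝ _ (lambdaMin A)).PosSemidef := by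
    rw [Matrix.posSemidef_iff_isHermitian_and_spectrum_nonneg]
    refine ⟨hA.sub ?_, ?_⟩
    · rw [Matrix.algebraMap_eq_diagonal]
      exact Matrix.isHermitian_diagonal _
    · rw [← spectrum.sub_singleton_eq]
      rintro _ ⟨x, hx, y, rfl, rfl⟩
      have hle : lambdaMin A ≤ x := csInf_le hbdd hx
      exact sub_nonneg.2 hle
  have h := hps.dotProduct_mulVec_nonneg v
  have h2 : (algebraMap ℝ (Matrix (Fin d) (Fin d) ℝ) (lambdaMin A)) *ᵥ v = lambdaMin A • v := by
    rw [Algebra.algebraMap_eq_smul_one, Matrix.smul_mulVec, Matrix.one_mulVec]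
  rw [Matrix.sub_mulVec, h2, star_trivial, dotProduct_sub, dotProduct_smul, smul_eq_mul] at h
  linarith

lemma lambdaMin_nonneg {A : Matrix (Fin d) (Fin d) ℝ} (hA : A.PosSemidef) : 0 ≤ lambdaMin A :=
  -- `Real.sInf_nonneg` also covers the empty spectrum (`d = 0`), where `sInf ∅ = 0`.
  Real.sInf_nonneg fun _ hx =>
    (Matrix.posSemidef_iff_isHermitian_and_spectrum_nonneg.1 hA).2 hx

lemma minOffDiagSq_nonneg (A : Matrix (Fin d) (Fin d) ℝ) : 0 ≤ minOffDiagSq A := by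
  refine Real.sInf_nonneg ?_
  rintro _ ⟨i, j, -, -, rfl⟩
  positivity

lemma minOffDiagSq_le {A : Matrix (Fin d) (Fin d) ℝ} {i j : Fin d} (hij : i ≠ j)
    (hA : A i j ≠ 0) : minOffDiagSq A ≤ A i j ^ 2 := by
  refine csInf_le ⟨0, ?_⟩ ⟨i, j, hij, hA, rfl⟩
  rintro _ ⟨i, j, -, -, rfl⟩
  positivity

lemma diag_le_spectralNorm {A : Matrix (Fin d) (Fin d) ℝ} (i : Fin d) : A i i ≤ spectralNorm A := by
  have h := dotProduct_mulVec_le A (Pi.single i 1)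
  simpa using h

lemma transpose_gram {n : ℕ} (X : Matrix (Fin n) (Fin d) ℝ) : (gram X)ᵀ = gram X := by
  simp [gram]

lemma posSemidef_gram {n : ℕ} (X : Matrix (Fin n) (Fin d) ℝ) : (gram X).PosSemidef := by
  have := Matrix.posSemidef_conjTranspose_mul_self X
  rwa [Matrix.conjTranspose_eq_transpose_of_trivial] at this

lemma transpose_shrink (p : ℝ) {A : Matrix (Fin d) (Fin d) ℝ} (hA : Aᵀ = A) :
    (shrink p A)ᵀ = shrink p A := by
  simp [shrink, hA]

lemma isHermitian_of_transpose {A : Matrix (Fin d) (Fin d) ℝ} (hA : Aᵀ = A) : A.IsHermitian := by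
  rw [Matrix.IsHermitian, Matrix.conjTranspose_eq_transpose_of_trivial, hA]

lemma norm_toLp_diagonal_mulVec_le {A : Matrix (Fin d) (Fin d) ℝ} (hA : A.PosSemidef)
    (v : Fin d → ℝ) :
    ‖WithLp.toLp 2 (Matrix.diagonal A.diag *ᵥ v)‖ ≤ spectralNorm A * ‖WithLp.toLp 2 v‖ := by
  refine le_of_sq_le_sq ?_ (mul_nonneg (spectralNorm_nonneg A) (norm_nonneg _))
  rw [mul_pow, norm_toLp_sq, norm_toLp_sq]
  simp only [dotProduct, Matrix.mulVec_diagonal, Finset.mul_sum, Matrix.diag]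
  refine Finset.sum_le_sum fun i _ => ?_
  have h0 : 0 ≤ A i i := hA.diag_nonneg
  have h1 := mul_self_le_mul_self h0 (diag_le_spectralNorm (A := A) i)
  nlinarith [mul_le_mul_of_nonneg_right h1 (mul_self_nonneg (v i))]

/-- `A_p` is a convex combination of `A` and its diagonal part, whose entries lie in `[0, ‖A‖]`. -/
lemma norm_toLp_shrink_mulVec_le {A : Matrix (Fin d) (Fin d) ℝ} (hA : A.PosSemidef)
    {p : ℝ} (hp0 : 0 ≤ p) (hp1 : p ≤ 1) (v : Fin d → ℝ) :
    ‖WithLp.toLp 2 (shrink p A *ᵥ v)‖ ≤ spectralNorm A * ‖WithLp.toLp 2 v‖ := by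
  rw [shrink, Matrix.add_mulVec, Matrix.smul_mulVec, Matrix.smul_mulVec, WithLp.toLp_add,
    WithLp.toLp_smul, WithLp.toLp_smul]
  refine (norm_add_le _ _).trans ?_
  rw [norm_smul, norm_smul, Real.norm_of_nonneg hp0, Real.norm_of_nonneg (sub_nonneg.2 hp1)]
  have h1 := mul_le_mul_of_nonneg_left (norm_toLp_mulVec_le A v) hp0
  have h2 := mul_le_mul_of_nonneg_left (norm_toLp_diagonal_mulVec_le hA v) (sub_nonneg.2 hp1)
  linarith

lemma dotProduct_shrink_mulVec_le {A : Matrix (Fin d) (Fin d) ℝ} (hA : A.PosSemidef)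
    {p : ℝ} (hp0 : 0 ≤ p) (hp1 : p ≤ 1) (v : Fin d → ℝ) :
    v ⬝ᵥ (shrink p A *ᵥ v) ≤ spectralNorm A * (v ⬝ᵥ v) := by
  calc v ⬝ᵥ (shrink p A *ᵥ v) ≤ ‖WithLp.toLp 2 v‖ * ‖WithLp.toLp 2 (shrink p A *ᵥ v)‖ :=
        dotProduct_le_norm_mul_norm _ _
    _ ≤ ‖WithLp.toLp 2 v‖ * (spectralNorm A * ‖WithLp.toLp 2 v‖) := by
        gcongr; exact norm_toLp_shrink_mulVec_le hA hp0 hp1 v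
    _ = _ := by rw [← norm_toLp_sq]; ring

end LinearAlgebra

/-! ### The dropout law as a finite weighted sum -/

section Weights

variable {d : ℕ}

/-- The diagonal of the dropout matrix that keeps exactly the coordinates in `s`. -/
def mask (s : Finset (Fin d)) : Fin d → ℝ := fun i => if i ∈ s then 1 else 0

/-- The probability that a dropout matrix keeps exactly the coordinates in `s`. -/
def weight (p : unitInterval) (s : Finset (Fin d)) : ℝ := (dropoutLaw d p).real {mask s}

lemma mask_mul_self (s : Finset (Fin d)) (i : Fin d) : mask s i * mask s i = mask s i := by
  simp [mask]

lemma mask_injective : Function.Injective (mask (d := d)) := by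
  intro s t h
  ext i
  have := congrFun h i
  by_cases hs : i ∈ s <;> by_cases ht : i ∈ t <;> simp_all [mask]

lemma weight_nonneg (p : unitInterval) (s : Finset (Fin d)) : 0 ≤ weight p s := measureReal_nonneg

instance (p : unitInterval) : IsProbabilityMeasure (dropoutLaw d p) := by
  unfold dropoutLaw; infer_instance

lemma ae_eq_zero_or_one (p : unitInterval) :
    ∀ᵐ x ∂(bernoulliMeasure (1 : ℝ) 0 p), x = 1 ∨ x = 0 := by
  rw [ae_iff]
  have hm : MeasurableSet {a : ℝ | ¬(a = 1 ∨ a = 0)} :=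
    ((MeasurableSet.singleton 1).union (MeasurableSet.singleton 0)).compl
  rw [bernoulliMeasure_apply_of_notMem_of_notMem p hm] <;> simp

lemma ae_exists_eq_mask (p : unitInterval) :
    ∀ᵐ x ∂(dropoutLaw d p), ∃ s : Finset (Fin d), x = mask s := by
  have h : ∀ᵐ x ∂(dropoutLaw d p), ∀ i, x i = 1 ∨ x i = 0 := by
    rw [ae_all_iff]
    intro i
    exact (Measure.quasiMeasurePreserving_eval
      (fun _ : Fin d => bernoulliMeasure (1 : ℝ) 0 p) i).ae (ae_eq_zero_or_one p)
  filter_upwards [h] with x hx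
  refine ⟨Finset.univ.filter fun i => x i = 1, funext fun i => ?_⟩
  rcases hx i with h | h <;> simp [mask, h]

/-- Averaging a function of an independent dropout mask over the finitely many values of the
mask. -/
lemma integral_dropout {Ω γ : Type*} [MeasurableSpace Ω] [MeasurableSpace γ] {P : Measure Ω}
    [IsProbabilityMeasure P] {p : unitInterval} {δ : Ω → Fin d → ℝ} {Z : Ω → γ}
    (hδ : Measurable δ) (hlaw : P.map δ = dropoutLaw d p) (hind : IndepFun δ Z P)
    (g : (Fin d → ℝ) → γ → ℝ) (hg : ∀ s, Measurable (g (mask s)))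
    (hint : ∀ s, Integrable (fun ω => g (mask s) (Z ω)) P) :
    Integrable (fun ω => g (δ ω) (Z ω)) P ∧
      ∫ ω, g (δ ω) (Z ω) ∂P = ∑ s, weight p s * ∫ ω, g (mask s) (Z ω) ∂P := by
  classical
  have hmask : ∀ᵐ ω ∂P, ∃ s : Finset (Fin d), δ ω = mask s := by
    refine ae_of_ae_map (p := fun x => ∃ s : Finset (Fin d), x = mask s) hδ.aemeasurable ?_
    rw [hlaw]
    exact ae_exists_eq_mask p
  let ind : Finset (Fin d) → (Fin d → ℝ) → ℝ := fun s => Set.indicator {mask s} 1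
  have hind_meas : ∀ s, Measurable (ind s) := fun s =>
    measurable_one.indicator (MeasurableSet.singleton _)
  -- Almost surely exactly one indicator is nonzero. Each indicator is a function of `δ` and each `g
  -- (mask s) (Z ω)` a function of `Z`, so every summand is a product of independent factors.
  have hae : (fun ω => g (δ ω) (Z ω)) =ᵐ[P]
      fun ω => ∑ s, ind s (δ ω) * g (mask s) (Z ω) := by
    filter_upwards [hmask] with ω ⟨s, hs⟩
    rw [Finset.sum_eq_single s]
    · simp [ind, hs]
    · intro t _ hts
      simp [ind, hs, mask_injective.ne hts.symm]
    · simp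
  have hintind : ∀ s, Integrable (fun ω => ind s (δ ω)) P := by
    intro s
    refine Integrable.of_bound ((hind_meas s).comp hδ).aestronglyMeasurable 1 (ae_of_all _ ?_)
    intro ω
    simp only [ind, Set.indicator]
    split_ifs <;> simp
  have hindep : ∀ s, IndepFun (fun ω => ind s (δ ω)) (fun ω => g (mask s) (Z ω)) P := fun s =>
    hind.comp (hind_meas s) (hg s)
  have hprod : ∀ s, Integrable (fun ω => ind s (δ ω) * g (mask s) (Z ω)) P := fun s =>
    (hindep s).integrable_mul (hintind s) (hint s)
  refine ⟨(integrable_finsetSum _ fun s _ => hprod s).congr hae.symm, ?_⟩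
  rw [integral_congr_ae hae, integral_finsetSum _ fun s _ => hprod s]
  refine Finset.sum_congr rfl fun s _ => ?_
  rw [(hindep s).integral_fun_mul_eq_mul_integral (hintind s).1 (hint s).1]
  congr 1
  rw [weight, ← hlaw, map_measureReal_apply hδ (MeasurableSet.singleton _),
    ← integral_indicator_one (hδ (MeasurableSet.singleton _))]
  rfl

lemma integral_dropoutLaw (p : unitInterval) (f : (Fin d → ℝ) → ℝ) :
    ∫ x, f x ∂(dropoutLaw d p) = ∑ s, weight p s * f (mask s) := by
  have h := (integral_dropout (P := dropoutLaw d p) (p := p) (δ := id) (Z := fun _ => ())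
    measurable_id Measure.map_id (indepFun_const_right _ _) (fun x _ => f x)
    (fun _ => measurable_const) (fun _ => integrable_const _)).2
  simpa using h

/-- By independence of the coordinates the expectation of the product factors. The weights are never
computed: every later average uses only these product moments, up to order three. -/
lemma sum_weight_mul_prod (p : unitInterval) (t : Finset (Fin d)) :
    ∑ s, weight p s * ∏ i ∈ t, mask s i = (p : ℝ) ^ t.card := by
  classical
  rw [← integral_dropoutLaw p fun x => ∏ i ∈ t, x i]
  have h := integral_fintype_prod_eq_prod (𝕜 := ℝ)
    (μ := fun _ : Fin d => bernoulliMeasure (1 : ℝ) 0 p) (fun i x => if i ∈ t then x else 1)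
  simp only [Finset.prod_ite_mem, Finset.univ_inter] at h
  rw [dropoutLaw, h]
  have h2 : ∀ i : Fin d, ∫ x, (if i ∈ t then x else 1) ∂(bernoulliMeasure (1 : ℝ) 0 p) =
      if i ∈ t then (p : ℝ) else 1 := by
    intro i
    rw [integral_bernoulliMeasure]
    split_ifs <;> simp
  simp [h2]

lemma sum_weight (p : unitInterval) : ∑ s : Finset (Fin d), weight p s = 1 := by
  simpa using sum_weight_mul_prod (d := d) p ∅

lemma sum_weight_mul_mask (p : unitInterval) (i : Fin d) :
    ∑ s, weight p s * mask s i = (p : ℝ) := by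
  simpa using sum_weight_mul_prod p {i}

lemma sum_weight_mul_mask_mul_mask (p : unitInterval) {i j : Fin d} (hij : i ≠ j) :
    ∑ s, weight p s * (mask s i * mask s j) = (p : ℝ) ^ 2 := by
  simpa [Finset.prod_pair hij, Finset.card_pair hij] using sum_weight_mul_prod p {i, j}

lemma sum_weight_mul_mask_mul_mask_mul_mask (p : unitInterval) {i j k : Fin d} (hij : i ≠ j)
    (hik : i ≠ k) (hjk : j ≠ k) :
    ∑ s, weight p s * (mask s i * (mask s j * mask s k)) = (p : ℝ) ^ 3 := by
  have h := sum_weight_mul_prod p {i, j, k}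
  rw [Finset.card_eq_three.2 ⟨i, j, k, hij, hik, hjk, rfl⟩] at h
  rw [← h]
  simp [Finset.prod_insert, hij, hik, hjk]

end Weights

/-! ### The random linear maps that drive the iteration -/

section Step

variable {d : ℕ}

/-- The linear part `1 - α D A D` of a dropout gradient step. -/
def stepMatrix (α : ℝ) (A : Matrix (Fin d) (Fin d) ℝ) (δ : Fin d → ℝ) : Matrix (Fin d) (Fin d) ℝ :=
  1 - α • (Matrix.diagonal δ * A * Matrix.diagonal δ)

/-- The matrix `α (D A_p - D A D)` that a dropout gradient step applies to the minimizer of the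
marginalized loss. -/
def noiseMatrix (α p : ℝ) (A : Matrix (Fin d) (Fin d) ℝ) (δ : Fin d → ℝ) :
    Matrix (Fin d) (Fin d) ℝ :=
  α • (Matrix.diagonal δ * shrink p A - Matrix.diagonal δ * A * Matrix.diagonal δ)

lemma transpose_stepMatrix (α : ℝ) {A : Matrix (Fin d) (Fin d) ℝ} (hA : Aᵀ = A)
    (δ : Fin d → ℝ) : (stepMatrix α A δ)ᵀ = stepMatrix α A δ := by
  simp [stepMatrix, hA, Matrix.mul_assoc]

lemma shrink_apply (p : ℝ) (A : Matrix (Fin d) (Fin d) ℝ) (i j : Fin d) :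
    shrink p A i j = if i = j then A i j else p * A i j := by
  rcases eq_or_ne i j with rfl | h
  · simp [shrink]; ring
  · simp [shrink, h]

/-- Off the diagonal two independent indicators contribute `p²`; on it `δ i ^ 2 = δ i` contributes
only `p`. This mismatch is the origin of `A_p`. -/
lemma sum_weight_smul_diagonal_mul_mul_diagonal (p : unitInterval)
    (A : Matrix (Fin d) (Fin d) ℝ) :
    ∑ s, weight p s • (Matrix.diagonal (mask s) * A * Matrix.diagonal (mask s)) =
      (p : ℝ) • shrink p A := by
  ext i j
  have h : ∀ s : Finset (Fin d), weight p s * (mask s i * A i j * mask s j) =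
      weight p s * (mask s i * mask s j) * A i j := fun s => by ring
  simp only [Matrix.sum_apply, Matrix.smul_apply, Matrix.mul_diagonal, Matrix.diagonal_mul,
    smul_eq_mul, h, ← Finset.sum_mul, shrink_apply]
  rcases eq_or_ne i j with rfl | hij
  · simp [mask_mul_self, sum_weight_mul_mask]
  · rw [sum_weight_mul_mask_mul_mask p hij, if_neg hij]; ring

lemma sum_weight_smul_diagonal_mul (p : unitInterval) (A : Matrix (Fin d) (Fin d) ℝ) :
    ∑ s, weight p s • (Matrix.diagonal (mask s) * A) = (p : ℝ) • A := by
  ext i j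
  simp only [Matrix.sum_apply, Matrix.smul_apply, Matrix.diagonal_mul, smul_eq_mul, ← mul_assoc,
    ← Finset.sum_mul, sum_weight_mul_mask]

lemma sum_weight_smul_stepMatrix (α : ℝ) (p : unitInterval) (A : Matrix (Fin d) (Fin d) ℝ) :
    ∑ s, weight p s • stepMatrix α A (mask s) = 1 - (α * p) • shrink p A := by
  simp only [stepMatrix, smul_sub, Finset.sum_sub_distrib, ← Finset.sum_smul, sum_weight,
    one_smul, smul_comm _ α, ← Finset.smul_sum, sum_weight_smul_diagonal_mul_mul_diagonal,
    mul_smul]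

lemma sum_weight_smul_noiseMatrix (α : ℝ) (p : unitInterval) (A : Matrix (Fin d) (Fin d) ℝ) :
    ∑ s, weight p s • noiseMatrix α p A (mask s) = 0 := by
  simp only [noiseMatrix, smul_comm _ α, ← Finset.smul_sum, smul_sub, Finset.sum_sub_distrib,
    sum_weight_smul_diagonal_mul_mul_diagonal, sum_weight_smul_diagonal_mul, sub_self]

lemma sum_weight_mul_dotProduct_mulVec (p : unitInterval) (A : Matrix (Fin d) (Fin d) ℝ)
    (u v : Fin d → ℝ) :
    ∑ s, weight p s *
        (u ⬝ᵥ ((Matrix.diagonal (mask s) * A * Matrix.diagonal (mask s)) *ᵥ v)) =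
      p * (u ⬝ᵥ (shrink p A *ᵥ v)) := by
  have h := congrArg (fun B => u ⬝ᵥ (B *ᵥ v)) (sum_weight_smul_diagonal_mul_mul_diagonal p A)
  simpa only [Matrix.sum_mulVec, dotProduct_sum, Matrix.smul_mulVec, dotProduct_smul,
    smul_eq_mul] using h

lemma sum_weight_mul_dotProduct_diagonal (p : unitInterval) (v : Fin d → ℝ) :
    ∑ s, weight p s *
        ((Matrix.diagonal (mask s) *ᵥ v) ⬝ᵥ (Matrix.diagonal (mask s) *ᵥ v)) =
      p * (v ⬝ᵥ v) := by
  simp only [dotProduct, Matrix.mulVec_diagonal, Finset.mul_sum]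
  rw [Finset.sum_comm]
  refine Finset.sum_congr rfl fun i _ => ?_
  have h : ∀ s : Finset (Fin d), weight p s * (mask s i * v i * (mask s i * v i)) =
      weight p s * mask s i * (v i * v i) := fun s => by
    rw [mul_assoc (weight p s)]
    nth_rewrite 3 [← mask_mul_self s i]
    ring
  simp only [h, ← Finset.sum_mul, sum_weight_mul_mask]

lemma diagonal_mask_dotProduct_le (s : Finset (Fin d)) (v : Fin d → ℝ) :
    (Matrix.diagonal (mask s) *ᵥ v) ⬝ᵥ (Matrix.diagonal (mask s) *ᵥ v) ≤ v ⬝ᵥ v := by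
  simp only [dotProduct, Matrix.mulVec_diagonal]
  refine Finset.sum_le_sum fun i _ => ?_
  by_cases h : i ∈ s <;> simp [mask, h, mul_self_nonneg]

lemma stepMatrix_dotProduct_self (α : ℝ) (A : Matrix (Fin d) (Fin d) ℝ) (δ v : Fin d → ℝ) :
    (stepMatrix α A δ *ᵥ v) ⬝ᵥ (stepMatrix α A δ *ᵥ v) =
      v ⬝ᵥ v - 2 * α * (v ⬝ᵥ ((Matrix.diagonal δ * A * Matrix.diagonal δ) *ᵥ v)) +
        α ^ 2 * (((Matrix.diagonal δ * A * Matrix.diagonal δ) *ᵥ v) ⬝ᵥ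
          ((Matrix.diagonal δ * A * Matrix.diagonal δ) *ᵥ v)) := by
  simp only [stepMatrix, Matrix.sub_mulVec, Matrix.one_mulVec, Matrix.smul_mulVec,
    sub_dotProduct, dotProduct_sub, smul_dotProduct, dotProduct_smul, smul_eq_mul]
  rw [dotProduct_comm ((Matrix.diagonal δ * A * Matrix.diagonal δ) *ᵥ v) v]
  ring

lemma sum_weight_mul_stepMatrix (α : ℝ) (p : unitInterval) (A : Matrix (Fin d) (Fin d) ℝ)
    (v : Fin d → ℝ) :
    ∑ s, weight p s * ((stepMatrix α A (mask s) *ᵥ v) ⬝ᵥ (stepMatrix α A (mask s) *ᵥ v)) =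
      v ⬝ᵥ v - 2 * α * (p * (v ⬝ᵥ (shrink p A *ᵥ v))) +
        α ^ 2 * ∑ s, weight p s *
          (((Matrix.diagonal (mask s) * A * Matrix.diagonal (mask s)) *ᵥ v) ⬝ᵥ
          ((Matrix.diagonal (mask s) * A * Matrix.diagonal (mask s)) *ᵥ v)) := by
  rw [← sum_weight_mul_dotProduct_mulVec, Finset.mul_sum, Finset.mul_sum]
  have h : v ⬝ᵥ v = ∑ s : Finset (Fin d), weight p s * (v ⬝ᵥ v) := by
    rw [← Finset.sum_mul, sum_weight, one_mul]
  nth_rewrite 1 [h]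
  rw [← Finset.sum_sub_distrib, ← Finset.sum_add_distrib]
  refine Finset.sum_congr rfl fun s _ => ?_
  rw [stepMatrix_dotProduct_self]
  ring

/-- In the expansion of `|v - α D A D v|²` the linear term averages to `p vᵀ A_p v`. The outer `D`
of the quadratic term is a projection and can be dropped, while the inner one is kept: `𝔼|D v|² = p
|v|²` supplies the factor `p` on the `α²` term. -/
lemma sum_weight_mul_stepMatrix_le {α : ℝ} (hα : 0 ≤ α) (p : unitInterval)
    {A : Matrix (Fin d) (Fin d) ℝ} (hA : Aᵀ = A) (v : Fin d → ℝ) :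
    ∑ s, weight p s * ((stepMatrix α A (mask s) *ᵥ v) ⬝ᵥ (stepMatrix α A (mask s) *ᵥ v)) ≤
      (1 - α * p * (2 * lambdaMin (shrink p A) - α * spectralNorm A ^ 2)) * (v ⬝ᵥ v) := by
  rw [sum_weight_mul_stepMatrix]
  have hp : (0 : ℝ) ≤ p := p.2.1
  have h1 := lambdaMin_mul_le (isHermitian_of_transpose (transpose_shrink (p : ℝ) hA)) v
  have h2 : ∑ s, weight p s *
          (((Matrix.diagonal (mask s) * A * Matrix.diagonal (mask s)) *ᵥ v) ⬝ᵥ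
          ((Matrix.diagonal (mask s) * A * Matrix.diagonal (mask s)) *ᵥ v)) ≤
      spectralNorm A ^ 2 * (p * (v ⬝ᵥ v)) := by
    rw [← sum_weight_mul_dotProduct_diagonal, Finset.mul_sum]
    refine Finset.sum_le_sum fun s _ => ?_
    rw [mul_left_comm]
    refine mul_le_mul_of_nonneg_left ?_ (weight_nonneg p s)
    rw [← Matrix.mulVec_mulVec, ← Matrix.mulVec_mulVec]
    exact (diagonal_mask_dotProduct_le s _).trans (mulVec_dotProduct_self_le A _)
  have h3 := mul_le_mul_of_nonneg_left h1 (mul_nonneg hα hp)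
  have h4 := mul_le_mul_of_nonneg_left h2 (sq_nonneg α)
  linarith

/-- The `α²` term is nonnegative and is discarded; `A_p ≤ ‖A‖ I` bounds the linear one. -/
lemma le_sum_weight_mul_stepMatrix {α : ℝ} (hα : 0 ≤ α) (p : unitInterval)
    {A : Matrix (Fin d) (Fin d) ℝ} (hA : A.PosSemidef) (v : Fin d → ℝ) :
    (1 - 2 * (α * p * spectralNorm A)) * (v ⬝ᵥ v) ≤
    ∑ s, weight p s *
      ((stepMatrix α A (mask s) *ᵥ v) ⬝ᵥ (stepMatrix α A (mask s) *ᵥ v)) := by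
  rw [sum_weight_mul_stepMatrix]
  have hp : (0 : ℝ) ≤ p := p.2.1
  have h1 := dotProduct_shrink_mulVec_le hA hp p.2.2 v
  have h2 : 0 ≤ ∑ s, weight p s *
          (((Matrix.diagonal (mask s) * A * Matrix.diagonal (mask s)) *ᵥ v) ⬝ᵥ
          ((Matrix.diagonal (mask s) * A * Matrix.diagonal (mask s)) *ᵥ v)) :=
    Finset.sum_nonneg fun s _ => mul_nonneg (weight_nonneg p s) (dotProduct_self_nonneg_real _)
  have h3 := mul_le_mul_of_nonneg_left h1 (mul_nonneg hα hp)
  have h4 := mul_nonneg (sq_nonneg α) h2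
  linarith

/-- The second moment of `(p - δ i) ∑ j, a j δ j`, when the sum does not involve `δ i`. -/
lemma sum_weight_mul_sq (p : unitInterval) (i : Fin d) {a : Fin d → ℝ} (ha : a i = 0) :
    ∑ s, weight p s * ((p - mask s i) * ∑ j, a j * mask s j) ^ 2 =
      p * (1 - p) * (p ^ 2 * (∑ j, a j) ^ 2 + p * (1 - p) * ∑ j, a j ^ 2) := by
  -- Since `δ i ^ 2 = δ i`, `(p - δ i)² = p² + (1 - 2 p) δ i`, so only product moments occur. The
  -- result is the variance `p (1 - p)` of `δ i` times the squared mean plus the variance of the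
  -- sum.
  have hexp : ∀ s : Finset (Fin d), weight p s * ((p - mask s i) * ∑ j, a j * mask s j) ^ 2 =
      ∑ j, ∑ k, a j * a k * ((p : ℝ) ^ 2 * (weight p s * (mask s j * mask s k)) +
        (1 - 2 * p) * (weight p s * (mask s i * (mask s j * mask s k)))) := by
    intro s
    rw [mul_pow, sq (∑ j, a j * mask s j), Finset.sum_mul_sum, Finset.mul_sum, Finset.mul_sum]
    refine Finset.sum_congr rfl fun j _ => ?_
    rw [Finset.mul_sum, Finset.mul_sum]
    refine Finset.sum_congr rfl fun k _ => ?_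
    have := mask_mul_self s i
    linear_combination weight p s * (a j * mask s j * (a k * mask s k)) * this
  have hmom : ∀ j k, a j * a k * ((p : ℝ) ^ 2 * ∑ s, weight p s * (mask s j * mask s k) +
        (1 - 2 * p) * ∑ s, weight p s * (mask s i * (mask s j * mask s k))) =
      p * (1 - p) * (p ^ 2 * (a j * a k) + if j = k then p * (1 - p) * a j ^ 2 else 0) := by
    intro j k
    by_cases hj : i = j
    · subst hj; simp [ha]
    by_cases hk : i = k
    · subst hk; simp [ha, Ne.symm hj]
    rcases eq_or_ne j k with rfl | hjk
    · simp only [mask_mul_self, sum_weight_mul_mask, sum_weight_mul_mask_mul_mask p hj, if_true]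
      ring
    · rw [sum_weight_mul_mask_mul_mask p hjk,
        sum_weight_mul_mask_mul_mask_mul_mask p hj hk hjk, if_neg hjk]
      ring
  calc ∑ s, weight p s * ((p - mask s i) * ∑ j, a j * mask s j) ^ 2
      = ∑ j, ∑ k, a j * a k * ((p : ℝ) ^ 2 * ∑ s, weight p s * (mask s j * mask s k) +
        (1 - 2 * p) * ∑ s, weight p s * (mask s i * (mask s j * mask s k))) := by
        rw [Finset.sum_congr rfl fun s _ => hexp s, Finset.sum_comm]
        refine Finset.sum_congr rfl fun j _ => ?_
        rw [Finset.sum_comm]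
        refine Finset.sum_congr rfl fun k _ => ?_
        rw [← Finset.mul_sum, Finset.sum_add_distrib, ← Finset.mul_sum, ← Finset.mul_sum]
    _ = _ := by
        simp only [hmom, mul_add, Finset.sum_add_distrib, ← Finset.mul_sum, mul_ite, mul_zero,
          Finset.sum_ite_eq, Finset.mem_univ, if_true, sq (∑ j, a j), Finset.sum_mul_sum]

/-- The diagonal entries of `D A_p` and `D A D` cancel because `A_p` keeps the diagonal of `A` and
`δ i ^ 2 = δ i`. Only off-diagonal entries of `A` produce noise, and the remaining sum does not
involve `δ i`. -/
lemma transpose_noiseMatrix_mulVec (α : ℝ) (p : ℝ) {A : Matrix (Fin d) (Fin d) ℝ}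
    (hA : Aᵀ = A) (s : Finset (Fin d)) (v : Fin d → ℝ) (i : Fin d) :
    ((noiseMatrix α p A (mask s))ᵀ *ᵥ v) i =
      α * ((p - mask s i) * ∑ j, (if j = i then 0 else A i j * v j) * mask s j) := by
  simp only [Matrix.mulVec, dotProduct, Finset.mul_sum]
  refine Finset.sum_congr rfl fun j _ => ?_
  have hsymm : A j i = A i j := by rw [← Matrix.transpose_apply A i j, hA]
  simp only [noiseMatrix, Matrix.transpose_apply, Matrix.smul_apply, Matrix.sub_apply,
    Matrix.diagonal_mul, Matrix.mul_diagonal, shrink_apply, smul_eq_mul, hsymm]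
  rcases eq_or_ne j i with rfl | hij
  · have := mask_mul_self s j
    simp only [if_true]
    linear_combination (-α * A j j * v j) * this
  · simp only [if_neg hij]
    ring

/-- Of each coordinate's second moment only the variance part `∑ j ≠ i, A i j ^ 2 * v j ^ 2` is
kept. After exchanging the sums, every `v j ^ 2` is multiplied by at least one nonzero `A m j ^ 2`,
which `hoff` provides. -/
lemma le_sum_weight_mul_noiseMatrix (α : ℝ) (p : unitInterval)
    {A : Matrix (Fin d) (Fin d) ℝ} (hA : Aᵀ = A) (hoff : ∀ l, ∃ m, m ≠ l ∧ A l m ≠ 0)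
    (v : Fin d → ℝ) :
    α ^ 2 * p ^ 2 * (1 - p) ^ 2 * minOffDiagSq A * (v ⬝ᵥ v) ≤
    ∑ s, weight p s * (((noiseMatrix α p A (mask s))ᵀ *ᵥ v) ⬝ᵥ
      ((noiseMatrix α p A (mask s))ᵀ *ᵥ v)) := by
  have hp0 : (0 : ℝ) ≤ p := p.2.1
  have hp1 : (0 : ℝ) ≤ 1 - p := sub_nonneg.2 p.2.2
  have hsum : ∑ s, weight p s * (((noiseMatrix α p A (mask s))ᵀ *ᵥ v) ⬝ᵥ
      ((noiseMatrix α p A (mask s))ᵀ *ᵥ v)) =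
      ∑ i, α ^ 2 * ∑ s, weight p s *
        ((p - mask s i) * ∑ j, (if j = i then 0 else A i j * v j) * mask s j) ^ 2 := by
    have h1 : ∀ s : Finset (Fin d), weight p s * (((noiseMatrix α p A (mask s))ᵀ *ᵥ v) ⬝ᵥ
        ((noiseMatrix α p A (mask s))ᵀ *ᵥ v)) = ∑ i, α ^ 2 * (weight p s *
        ((p - mask s i) * ∑ j, (if j = i then 0 else A i j * v j) * mask s j) ^ 2) := by
      intro s
      rw [dotProduct, Finset.mul_sum]
      refine Finset.sum_congr rfl fun i _ => ?_
      rw [transpose_noiseMatrix_mulVec α p hA]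
      ring
    rw [Finset.sum_congr rfl fun s _ => h1 s, Finset.sum_comm]
    simp only [← Finset.mul_sum (s := (Finset.univ : Finset (Finset (Fin d))))]
  rw [hsum]
  have hterm : ∀ i, α ^ 2 * (p * (1 - p) * (p * (1 - p) *
      ∑ j, (if j = i then 0 else A i j * v j) ^ 2)) ≤ α ^ 2 * ∑ s, weight p s *
        ((p - mask s i) * ∑ j, (if j = i then 0 else A i j * v j) * mask s j) ^ 2 := by
    intro i
    rw [sum_weight_mul_sq p i (by simp)]
    gcongr
    exact le_add_of_nonneg_left (by positivity)
  refine le_trans ?_ (Finset.sum_le_sum fun i _ => hterm i)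
  simp only [← Finset.mul_sum]
  rw [Finset.sum_comm]
  have hkey : minOffDiagSq A * (v ⬝ᵥ v) ≤
      ∑ j, ∑ i, (if j = i then 0 else A i j * v j) ^ 2 := by
    rw [dotProduct, Finset.mul_sum]
    refine Finset.sum_le_sum fun j _ => ?_
    obtain ⟨m, hm, hAm⟩ := hoff j
    have hsymm : A m j = A j m := by rw [← Matrix.transpose_apply A j m, hA]
    refine le_trans ?_ (Finset.single_le_sum (fun i _ => sq_nonneg _) (Finset.mem_univ m))
    rw [if_neg hm.symm, hsymm, mul_pow, ← sq]
    exact mul_le_mul_of_nonneg_right (minOffDiagSq_le hm.symm hAm) (sq_nonneg _)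
  have := mul_le_mul_of_nonneg_left hkey
    (by positivity : 0 ≤ α ^ 2 * (p * (1 - p) * (p * (1 - p)) : ℝ))
  linarith

end Step

/-! ### The minimizer of the marginalized loss -/

section Minimizer

variable {n d : ℕ}

/-- The loss is quadratic, so its expansion is exact. The first order term at `b` is `2 p (A_p b -
Xᵀ y) ⬝ᵥ h`, which the normal equation kills. -/
lemma marginalLoss_eq (X : Matrix (Fin n) (Fin d) ℝ) (p : unitInterval) {y : Fin n → ℝ}
    {b : Fin d → ℝ} (hb : shrink p (gram X) *ᵥ b = Xᵀ *ᵥ y) (h : Fin d → ℝ) :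
    marginalLoss X p y (b + h) =
      marginalLoss X p y b + p * (h ⬝ᵥ (shrink p (gram X) *ᵥ h)) := by
  have hloss : ∀ c, marginalLoss X p y c = ∑ s, weight p s *
      ((y - X *ᵥ (Matrix.diagonal (mask s) *ᵥ c)) ⬝ᵥ
        (y - X *ᵥ (Matrix.diagonal (mask s) *ᵥ c))) := by
    intro c
    rw [marginalLoss, integral_dropoutLaw]
    simp [dotProduct, sq]
  have hquad : ∀ s : Finset (Fin d), ∀ u w : Fin d → ℝ,
      (X *ᵥ (Matrix.diagonal (mask s) *ᵥ u)) ⬝ᵥ (X *ᵥ (Matrix.diagonal (mask s) *ᵥ w)) =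
      u ⬝ᵥ ((Matrix.diagonal (mask s) * gram X * Matrix.diagonal (mask s)) *ᵥ w) := by
    intro s u w
    rw [gram, dotProduct_comm u, ← Matrix.mulVec_mulVec, ← Matrix.mulVec_mulVec,
      ← Matrix.mulVec_mulVec, dotProduct_comm _ u, Matrix.dotProduct_mulVec u,
      ← Matrix.mulVec_transpose, Matrix.diagonal_transpose, Matrix.dotProduct_mulVec _ Xᵀ,
      Matrix.vecMul_transpose]
  have hlin : ∑ s, weight p s * (y ⬝ᵥ (X *ᵥ (Matrix.diagonal (mask s) *ᵥ h))) =
      p * ((Xᵀ *ᵥ y) ⬝ᵥ h) := by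
    have h1 : ∀ s : Finset (Fin d), weight p s * (y ⬝ᵥ (X *ᵥ (Matrix.diagonal (mask s) *ᵥ h))) =
        ∑ i, weight p s * mask s i * ((Xᵀ *ᵥ y) i * h i) := by
      intro s
      rw [Matrix.dotProduct_mulVec, ← Matrix.mulVec_transpose, dotProduct, Finset.mul_sum]
      refine Finset.sum_congr rfl fun i _ => ?_
      rw [Matrix.mulVec_diagonal]; ring
    simp only [h1]
    rw [Finset.sum_comm]
    simp only [← Finset.sum_mul, sum_weight_mul_mask, dotProduct, Finset.mul_sum]
  have hcross := sum_weight_mul_dotProduct_mulVec p (gram X) b h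
  have hsq := sum_weight_mul_dotProduct_mulVec p (gram X) h h
  have hsymm : b ⬝ᵥ (shrink p (gram X) *ᵥ h) = (Xᵀ *ᵥ y) ⬝ᵥ h := by
    rw [Matrix.dotProduct_mulVec, ← Matrix.mulVec_transpose,
      transpose_shrink _ (transpose_gram X), hb]
  rw [hloss, hloss, ← hsq]
  have hexp : ∀ s : Finset (Fin d), weight p s *
      ((y - X *ᵥ (Matrix.diagonal (mask s) *ᵥ (b + h))) ⬝ᵥ
        (y - X *ᵥ (Matrix.diagonal (mask s) *ᵥ (b + h)))) =
      weight p s * ((y - X *ᵥ (Matrix.diagonal (mask s) *ᵥ b)) ⬝ᵥ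
        (y - X *ᵥ (Matrix.diagonal (mask s) *ᵥ b))) +
      weight p s * (h ⬝ᵥ
        ((Matrix.diagonal (mask s) * gram X * Matrix.diagonal (mask s)) *ᵥ h)) -
      2 * (weight p s * (y ⬝ᵥ (X *ᵥ (Matrix.diagonal (mask s) *ᵥ h)))) +
      2 * (weight p s * (b ⬝ᵥ
        ((Matrix.diagonal (mask s) * gram X * Matrix.diagonal (mask s)) *ᵥ h))) := by
    intro s
    rw [← hquad, ← hquad, Matrix.mulVec_add, Matrix.mulVec_add]
    simp only [sub_dotProduct, dotProduct_sub, add_dotProduct, dotProduct_add]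
    rw [dotProduct_comm (X *ᵥ (Matrix.diagonal (mask s) *ᵥ h)) y,
      dotProduct_comm (X *ᵥ (Matrix.diagonal (mask s) *ᵥ h))
        (X *ᵥ (Matrix.diagonal (mask s) *ᵥ b))]
    ring
  simp only [hexp, Finset.sum_add_distrib, Finset.sum_sub_distrib, ← Finset.mul_sum]
  rw [hlin, hcross, hsymm]
  ring

lemma marginalMinimizer_eq (X : Matrix (Fin n) (Fin d) ℝ) (p : unitInterval) (hp : 0 < p)
    (hpos : 0 < lambdaMin (shrink p (gram X))) {y : Fin n → ℝ}
    {b : Fin d → ℝ} (hb : shrink p (gram X) *ᵥ b = Xᵀ *ᵥ y) :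
    marginalMinimizer X p y = b := by
  have hp' : (0 : ℝ) < p := hp
  have hH := isHermitian_of_transpose (transpose_shrink (p : ℝ) (transpose_gram X))
  have hmin : ∀ b', marginalLoss X p y b ≤ marginalLoss X p y b' := by
    intro b'
    have h := marginalLoss_eq X p hb (b' - b)
    rw [add_sub_cancel] at h
    rw [h]
    refine le_add_of_nonneg_right (mul_nonneg hp'.le ?_)
    exact (mul_nonneg hpos.le (dotProduct_self_nonneg_real _)).trans (lambdaMin_mul_le hH _)
  have hspec := Classical.epsilon_spec
    (p := fun b => ∀ b', marginalLoss X p y b ≤ marginalLoss X p y b') ⟨b, hmin⟩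
  have h1 := hspec b
  change marginalLoss X p y (marginalMinimizer X p y) ≤ _ at h1
  set c := marginalMinimizer X p y
  have h := marginalLoss_eq X p hb (c - b)
  rw [add_sub_cancel] at h
  have h2 := mul_le_mul_of_nonneg_left (lambdaMin_mul_le hH (c - b)) hp'.le
  have h3 : (c - b) ⬝ᵥ (c - b) ≤ 0 := by
    by_contra hcon
    have := mul_pos hp' (mul_pos hpos (not_le.1 hcon))
    linarith
  have h4 := dotProduct_self_eq_zero.1 (le_antisymm h3 (dotProduct_self_nonneg_real _))
  exact sub_eq_zero.1 h4

end Minimizer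

/-! ### Affine recursions with a contractive linear part -/

section Contraction

lemma tendsto_zero_of_le_mul_add {b g : ℕ → ℝ} {ρ : ℝ} (hρ0 : 0 ≤ ρ) (hρ1 : ρ < 1)
    (hb : ∀ k, 0 ≤ b k) (hg : Tendsto g atTop (𝓝 0))
    (hstep : ∀ k, b (k + 1) ≤ ρ * b k + g k) : Tendsto b atTop (𝓝 0) := by
  rw [Metric.tendsto_atTop]
  intro ε hε
  -- With forcing at most this, `ε / 2` is the fixed point of the scalar recursion, and the excess
  -- above it decays like `ρ ^ j`.
  have hε' : 0 < ε / 2 * (1 - ρ) := mul_pos (half_pos hε) (sub_pos.2 hρ1)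
  obtain ⟨K, hK⟩ := eventually_atTop.1 (hg.eventually_lt_const hε')
  have hbound : ∀ j, b (K + j) ≤ ε / 2 + ρ ^ j * b K := by
    intro j
    induction j with
    | zero => simpa using (half_pos hε).le
    | succ j ih =>
      have h1 := hstep (K + j)
      have h2 := hK (K + j) (Nat.le_add_right _ _)
      have h3 := mul_le_mul_of_nonneg_left ih hρ0
      rw [← add_assoc, pow_succ]
      nlinarith
  have hpow : Tendsto (fun j => ρ ^ j * b K) atTop (𝓝 0) := by
    simpa using (tendsto_pow_atTop_nhds_zero_of_lt_one hρ0 hρ1).mul_const (b K)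
  obtain ⟨J, hJ⟩ := eventually_atTop.1 (hpow.eventually_lt_const (half_pos hε))
  refine ⟨K + J, fun k hk => ?_⟩
  obtain ⟨j, rfl⟩ := Nat.exists_eq_add_of_le (le_trans (Nat.le_add_right K J) hk)
  have hj : J ≤ j := by omega
  rw [Real.dist_0_eq_abs, abs_of_nonneg (hb _)]
  linarith [hbound j, hJ j hj]

/-- Banach's theorem for the limiting map `T + f₀` gives `x₀`; the distance to it then contracts up
to the vanishing perturbation `f k - f₀`. -/
lemma exists_fixedPoint_tendsto {E : Type*} [NormedAddCommGroup E] [CompleteSpace E]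
    (T : E →+ E) {ρ : ℝ} (hρ0 : 0 ≤ ρ) (hρ1 : ρ < 1) (hT : ∀ x, ‖T x‖ ≤ ρ * ‖x‖)
    {x f : ℕ → E} {f₀ : E} (hf : Tendsto f atTop (𝓝 f₀)) (hstep : ∀ k, x (k + 1) = T (x k) + f k) :
    ∃ x₀, x₀ = T x₀ + f₀ ∧ Tendsto x atTop (𝓝 x₀) := by
  have hcontr : ContractingWith ⟨ρ, hρ0⟩ fun y => T y + f₀ := by
    refine ⟨hρ1, LipschitzWith.of_dist_le_mul fun y z => ?_⟩
    rw [dist_add_right, dist_eq_norm, dist_eq_norm, ← map_sub]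
    exact hT _
  have hfix := hcontr.fixedPoint_isFixedPt
  set x₀ := ContractingWith.fixedPoint (fun y => T y + f₀) hcontr
  have hx₀ : x₀ = T x₀ + f₀ := hfix.symm
  refine ⟨x₀, hx₀, ?_⟩
  rw [tendsto_iff_norm_sub_tendsto_zero]
  refine tendsto_zero_of_le_mul_add hρ0 hρ1 (fun _ => norm_nonneg _)
    (tendsto_iff_norm_sub_tendsto_zero.1 hf) fun k => ?_
  have h : x (k + 1) - x₀ = T (x k - x₀) + (f k - f₀) := by
    rw [hstep, map_sub]
    nth_rewrite 1 [hx₀]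
    abel
  rw [h]
  exact (norm_add_le _ _).trans (add_le_add (hT _) le_rfl)

variable {d : ℕ}

lemma spectralNorm_le {A : Matrix (Fin d) (Fin d) ℝ} {c : ℝ} (hc : 0 ≤ c)
    (h : ∀ v : Fin d → ℝ, ‖WithLp.toLp 2 (A *ᵥ v)‖ ≤ c * ‖WithLp.toLp 2 v‖) :
    spectralNorm A ≤ c :=
  ContinuousLinearMap.opNorm_le_bound _ hc fun v => h v.ofLp

/-- With `u` the image of `v`, `|u|² = ∑ w (U u) ⬝ᵥ (M V v)`. Weighted Cauchy-Schwarz bounds this by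
`‖M‖ (a |u|) (b |v|)`, and one factor `|u|` cancels. Only mean square bounds on `U` and `V` are
needed, not uniform ones. -/
lemma spectralNorm_sum_le {ι : Type*} [Fintype ι] {w : ι → ℝ} (hw : ∀ s, 0 ≤ w s)
    (U V : ι → Matrix (Fin d) (Fin d) ℝ) (M : Matrix (Fin d) (Fin d) ℝ) {a b : ℝ}
    (ha : 0 ≤ a) (hb : 0 ≤ b)
    (hU : ∀ v, ∑ s, w s * ((U s *ᵥ v) ⬝ᵥ (U s *ᵥ v)) ≤ a ^ 2 * (v ⬝ᵥ v))
    (hV : ∀ v, ∑ s, w s * ((V s *ᵥ v) ⬝ᵥ (V s *ᵥ v)) ≤ b ^ 2 * (v ⬝ᵥ v)) :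
    spectralNorm (∑ s, w s • ((U s)ᵀ * M * V s)) ≤ a * b * spectralNorm M := by
  have hM := spectralNorm_nonneg M
  refine spectralNorm_le (by positivity) fun v => ?_
  set u := (∑ s, w s • ((U s)ᵀ * M * V s)) *ᵥ v with hu
  have h1 : ‖WithLp.toLp 2 u‖ ^ 2 =
      ∑ s, w s * ((U s *ᵥ u) ⬝ᵥ (M *ᵥ (V s *ᵥ v))) := by
    rw [norm_toLp_sq]
    nth_rewrite 2 [hu]
    rw [Matrix.sum_mulVec, dotProduct_sum]
    refine Finset.sum_congr rfl fun s _ => ?_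
    rw [Matrix.smul_mulVec, dotProduct_smul, smul_eq_mul, ← Matrix.mulVec_mulVec,
      ← Matrix.mulVec_mulVec, Matrix.dotProduct_mulVec, Matrix.vecMul_transpose]
  set S := ∑ s, w s * (‖WithLp.toLp 2 (U s *ᵥ u)‖ * ‖WithLp.toLp 2 (V s *ᵥ v)‖)
  have hS0 : 0 ≤ S := Finset.sum_nonneg fun s _ =>
    mul_nonneg (hw s) (mul_nonneg (norm_nonneg _) (norm_nonneg _))
  have h2 : ‖WithLp.toLp 2 u‖ ^ 2 ≤ spectralNorm M * S := by
    rw [h1, Finset.mul_sum]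
    refine Finset.sum_le_sum fun s _ => ?_
    rw [mul_left_comm]
    refine mul_le_mul_of_nonneg_left ?_ (hw s)
    refine (dotProduct_le_norm_mul_norm _ _).trans ?_
    have := mul_le_mul_of_nonneg_left (norm_toLp_mulVec_le M (V s *ᵥ v))
      (norm_nonneg (WithLp.toLp 2 (U s *ᵥ u)))
    linarith
  have h3 : S ≤ a * ‖WithLp.toLp 2 u‖ * (b * ‖WithLp.toLp 2 v‖) := by
    refine le_of_sq_le_sq ?_ (by positivity)
    calc S ^ 2 ≤ (∑ s, w s * ((U s *ᵥ u) ⬝ᵥ (U s *ᵥ u))) *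
          ∑ s, w s * ((V s *ᵥ v) ⬝ᵥ (V s *ᵥ v)) := by
          refine Finset.sum_sq_le_sum_mul_sum_of_sq_le_mul _
            (fun s _ => mul_nonneg (hw s) (dotProduct_self_nonneg_real _))
            (fun s _ => mul_nonneg (hw s) (dotProduct_self_nonneg_real _)) fun s _ => ?_
          rw [← norm_toLp_sq, ← norm_toLp_sq]
          exact le_of_eq (by ring)
      _ ≤ (a ^ 2 * (u ⬝ᵥ u)) * (b ^ 2 * (v ⬝ᵥ v)) :=
          mul_le_mul (hU u) (hV v)
            (Finset.sum_nonneg fun s _ => mul_nonneg (hw s) (dotProduct_self_nonneg_real _))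
            (mul_nonneg (sq_nonneg _) (dotProduct_self_nonneg_real _))
      _ = _ := by rw [← norm_toLp_sq, ← norm_toLp_sq]; ring
  have h4 := h2.trans (mul_le_mul_of_nonneg_left h3 hM)
  rcases (norm_nonneg (WithLp.toLp 2 u)).eq_or_lt' with h0 | h0
  · rw [h0]; positivity
  · refine le_of_mul_le_mul_left ?_ h0
    linarith

/-- The matrix `𝔼[(1 - α D A D) M (1 - α D A D)ᵀ]`, as an additive function of `M`. -/
def stepAverage (α : ℝ) (p : unitInterval) (A : Matrix (Fin d) (Fin d) ℝ) :
    Matrix (Fin d) (Fin d) ℝ →+ Matrix (Fin d) (Fin d) ℝ where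
  toFun M := ∑ s, weight p s •
    (stepMatrix α A (mask s) * M * (stepMatrix α A (mask s))ᵀ)
  map_zero' := by simp
  map_add' M N := by
    simp only [Matrix.mul_add, Matrix.add_mul, smul_add, Finset.sum_add_distrib]

lemma stepAverage_apply (α : ℝ) (p : unitInterval) (A M : Matrix (Fin d) (Fin d) ℝ) :
    stepAverage α p A M = ∑ s, weight p s •
      (stepMatrix α A (mask s) * M * (stepMatrix α A (mask s))ᵀ) := rfl

lemma spectralNorm_stepAverage_le {α : ℝ} {p : unitInterval} {A : Matrix (Fin d) (Fin d) ℝ}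
    (hA : Aᵀ = A) {r : ℝ} (hr : 0 ≤ r)
    (hstep : ∀ v, ∑ s, weight p s *
      ((stepMatrix α A (mask s) *ᵥ v) ⬝ᵥ (stepMatrix α A (mask s) *ᵥ v)) ≤ r ^ 2 * (v ⬝ᵥ v))
    (M : Matrix (Fin d) (Fin d) ℝ) :
    spectralNorm (stepAverage α p A M) ≤ r * r * spectralNorm M := by
  have h := spectralNorm_sum_le (weight_nonneg p) (fun s => stepMatrix α A (mask s))
    (fun s => stepMatrix α A (mask s)) M hr hr hstep hstep
  simpa only [stepAverage_apply, transpose_stepMatrix α hA] using h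

/-- The mean of a random matrix is controlled by its second moment: this is the Cauchy-Schwarz bound
with `U = M = 1`. -/
lemma spectralNorm_one_sub_shrink_le {α : ℝ} {p : unitInterval} {A : Matrix (Fin d) (Fin d) ℝ}
    {r : ℝ} (hr : 0 ≤ r)
    (hstep : ∀ v, ∑ s, weight p s *
      ((stepMatrix α A (mask s) *ᵥ v) ⬝ᵥ (stepMatrix α A (mask s) *ᵥ v)) ≤ r ^ 2 * (v ⬝ᵥ v)) :
    spectralNorm (1 - (α * p) • shrink p A) ≤ r := by
  have h := spectralNorm_sum_le (weight_nonneg p) (fun _ => 1)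
    (fun s => stepMatrix α A (mask s)) 1 zero_le_one hr
    (fun v => by simp [← Finset.sum_mul, sum_weight]) hstep
  have h1 : spectralNorm (1 : Matrix (Fin d) (Fin d) ℝ) ≤ 1 :=
    spectralNorm_le zero_le_one fun v => by simp
  simp only [Matrix.transpose_one, Matrix.one_mul, sum_weight_smul_stepMatrix] at h
  exact h.trans (by nlinarith)

-- In this scope the matrix norm unfolds to `spectralNorm`.
open scoped Matrix.Norms.L2Operator in
lemma tendsto_pow_of_spectralNorm_lt_one {G : Matrix (Fin d) (Fin d) ℝ}
    (hG : spectralNorm G < 1) : Tendsto (fun k => G ^ k) atTop (𝓝 0) :=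
  tendsto_pow_atTop_nhds_zero_of_norm_lt_one hG

open scoped Matrix.Norms.L2Operator in
lemma exists_fixedPoint_tendsto_matrix
    (T : Matrix (Fin d) (Fin d) ℝ →+ Matrix (Fin d) (Fin d) ℝ) {ρ : ℝ} (hρ0 : 0 ≤ ρ)
    (hρ1 : ρ < 1) (hT : ∀ M, spectralNorm (T M) ≤ ρ * spectralNorm M)
    {x f : ℕ → Matrix (Fin d) (Fin d) ℝ} {f₀ : Matrix (Fin d) (Fin d) ℝ}
    (hf : Tendsto f atTop (𝓝 f₀)) (hstep : ∀ k, x (k + 1) = T (x k) + f k) :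
    ∃ x₀, x₀ = T x₀ + f₀ ∧ Tendsto x atTop (𝓝 x₀) :=
  haveI : CompleteSpace (Matrix (Fin d) (Fin d) ℝ) := FiniteDimensional.complete ℝ _
  exists_fixedPoint_tendsto T hρ0 hρ1 hT hf hstep

lemma dotProduct_conj_mulVec (Q M : Matrix (Fin d) (Fin d) ℝ) (v : Fin d → ℝ) :
    v ⬝ᵥ ((Q * M * Qᵀ) *ᵥ v) = (Qᵀ *ᵥ v) ⬝ᵥ (M *ᵥ (Qᵀ *ᵥ v)) := by
  rw [← Matrix.mulVec_mulVec, ← Matrix.mulVec_mulVec, Matrix.dotProduct_mulVec v Q,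
    ← Matrix.mulVec_transpose]

/-- A lower bound for the positive semidefinite solution of the stationary second moment
equation. -/
lemma le_dotProduct_mulVec_of_fixedPoint {α : ℝ} (hα : 0 < α) {p : unitInterval}
    {A M S : Matrix (Fin d) (Fin d) ℝ} (hA : A.PosSemidef) (hAt : Aᵀ = A)
    (hoff : ∀ l, ∃ m, m ≠ l ∧ A l m ≠ 0) (hx0 : 0 < α * p * spectralNorm A)
    (hx1 : α * p * spectralNorm A < 1)
    (hM : ∀ v, 0 ≤ v ⬝ᵥ (M *ᵥ v)) {σ c : ℝ} (hσ : 0 ≤ σ)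
    (hS : ∀ v, σ * (v ⬝ᵥ v) ≤ v ⬝ᵥ (S *ᵥ v))
    (hfix : M = stepAverage α p A M + ∑ s, weight p s •
      (noiseMatrix α p A (mask s) * S * (noiseMatrix α p A (mask s))ᵀ))
    (hc0 : 0 ≤ c)
    (hc : c * (2 * (α * p * spectralNorm A)) =
      σ * (α ^ 2 * p ^ 2 * (1 - p) ^ 2 * minOffDiagSq A))
    (v : Fin d → ℝ) : c * (v ⬝ᵥ v) ≤ v ⬝ᵥ (M *ᵥ v) := by
  -- `q` may be negative; `α p ‖A‖ < 1` ensures `|q| < 1`, which is all the geometric series needs.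
  set q := 1 - 2 * (α * p * spectralNorm A) with hq
  have hq1 : |q| < 1 := abs_lt.2 ⟨by linarith, by linarith⟩
  have hquad : ∀ v, v ⬝ᵥ (M *ᵥ v) =
      (∑ s, weight p s * ((stepMatrix α A (mask s) *ᵥ v) ⬝ᵥ
        (M *ᵥ (stepMatrix α A (mask s) *ᵥ v)))) +
      ∑ s, weight p s * (((noiseMatrix α p A (mask s))ᵀ *ᵥ v) ⬝ᵥ
        (S *ᵥ ((noiseMatrix α p A (mask s))ᵀ *ᵥ v))) := by
    intro v
    nth_rewrite 1 [hfix]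
    simp only [stepAverage_apply, Matrix.add_mulVec, dotProduct_add, Matrix.sum_mulVec,
      dotProduct_sum, Matrix.smul_mulVec, dotProduct_smul, smul_eq_mul, dotProduct_conj_mulVec]
    simp only [transpose_stepMatrix α hAt]
  -- Feeding `M ≥ c (1 - q ^ k) I` back into the equation gives `c (1 - q ^ k) q + c (1 - q) = c (1
  -- - q ^ (k + 1))`, starting from `M ≥ 0`.
  have hiter : ∀ k : ℕ, ∀ v, c * (1 - q ^ k) * (v ⬝ᵥ v) ≤ v ⬝ᵥ (M *ᵥ v) := by
    intro k
    induction k with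
    | zero => intro v; simpa using hM v
    | succ k ih =>
      intro v
      have hqk : q ^ k ≤ 1 := (le_abs_self _).trans (by
        rw [abs_pow]; exact pow_le_one₀ (abs_nonneg _) hq1.le)
      have hck : 0 ≤ c * (1 - q ^ k) := mul_nonneg hc0 (sub_nonneg.2 hqk)
      have h1 : c * (1 - q ^ k) * (q * (v ⬝ᵥ v)) ≤
          ∑ s, weight p s * ((stepMatrix α A (mask s) *ᵥ v) ⬝ᵥ
            (M *ᵥ (stepMatrix α A (mask s) *ᵥ v))) := by
        refine (mul_le_mul_of_nonneg_left
          (le_sum_weight_mul_stepMatrix hα.le p hA v) hck).trans ?_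
        rw [Finset.mul_sum]
        refine Finset.sum_le_sum fun s _ => ?_
        rw [mul_left_comm]
        exact mul_le_mul_of_nonneg_left (ih _) (weight_nonneg p s)
      have h2 : σ * (α ^ 2 * p ^ 2 * (1 - p) ^ 2 * minOffDiagSq A * (v ⬝ᵥ v)) ≤
          ∑ s, weight p s * (((noiseMatrix α p A (mask s))ᵀ *ᵥ v) ⬝ᵥ
            (S *ᵥ ((noiseMatrix α p A (mask s))ᵀ *ᵥ v))) := by
        refine (mul_le_mul_of_nonneg_left
          (le_sum_weight_mul_noiseMatrix α p hAt hoff v) hσ).trans ?_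
        rw [Finset.mul_sum]
        refine Finset.sum_le_sum fun s _ => ?_
        rw [mul_left_comm]
        exact mul_le_mul_of_nonneg_left (hS _) (weight_nonneg p s)
      rw [hquad v]
      have h3 : c * (1 - q ^ (k + 1)) * (v ⬝ᵥ v) = c * (1 - q ^ k) * (q * (v ⬝ᵥ v)) +
          σ * (α ^ 2 * p ^ 2 * (1 - p) ^ 2 * minOffDiagSq A * (v ⬝ᵥ v)) := by
        have : c * (1 - q) = σ * (α ^ 2 * p ^ 2 * (1 - p) ^ 2 * minOffDiagSq A) := by
          rw [← hc, hq]; ring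
        rw [pow_succ]
        linear_combination (v ⬝ᵥ v) * this
      linarith
  have hlim : Tendsto (fun k : ℕ => c * (1 - q ^ k) * (v ⬝ᵥ v)) atTop (𝓝 (c * (v ⬝ᵥ v))) := by
    have := (((tendsto_pow_atTop_nhds_zero_of_abs_lt_one hq1).const_sub 1).const_mul c).mul_const
      (v ⬝ᵥ v)
    simpa using this
  exact le_of_tendsto' hlim fun k => hiter k v

end Contraction

/-! ### Second moment matrices -/

section Moments

variable {Ω : Type*} [MeasurableSpace Ω] {P : Measure Ω} {a b c : ℕ}

/-- The matrix `𝔼[U Vᵀ]`. -/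
def crossMoment (U : Ω → Fin a → ℝ) (V : Ω → Fin b → ℝ) (P : Measure Ω) :
    Matrix (Fin a) (Fin b) ℝ :=
  Matrix.of fun i j => ∫ ω, U ω i * V ω j ∂P

lemma transpose_crossMoment (U : Ω → Fin a → ℝ) (V : Ω → Fin b → ℝ) :
    (crossMoment U V P)ᵀ = crossMoment V U P := by
  ext i j
  simp [crossMoment, mul_comm]

lemma crossMoment_add_left {U U' : Ω → Fin a → ℝ} {V : Ω → Fin b → ℝ}
    (hU : ∀ i, MemLp (fun ω => U ω i) 2 P) (hU' : ∀ i, MemLp (fun ω => U' ω i) 2 P)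
    (hV : ∀ i, MemLp (fun ω => V ω i) 2 P) :
    crossMoment (fun ω => U ω + U' ω) V P = crossMoment U V P + crossMoment U' V P := by
  ext i j
  simp only [crossMoment, Matrix.of_apply, Matrix.add_apply, Pi.add_apply, add_mul]
  exact integral_add ((hU i).integrable_mul (hV j)) ((hU' i).integrable_mul (hV j))

lemma crossMoment_add_right {U : Ω → Fin a → ℝ} {V V' : Ω → Fin b → ℝ}
    (hU : ∀ i, MemLp (fun ω => U ω i) 2 P) (hV : ∀ i, MemLp (fun ω => V ω i) 2 P)
    (hV' : ∀ i, MemLp (fun ω => V' ω i) 2 P) :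
    crossMoment U (fun ω => V ω + V' ω) P = crossMoment U V P + crossMoment U V' P := by
  rw [← transpose_crossMoment, crossMoment_add_left hV hV' hU, Matrix.transpose_add,
    transpose_crossMoment, transpose_crossMoment]

lemma memLp_mulVec (A : Matrix (Fin c) (Fin a) ℝ) {U : Ω → Fin a → ℝ}
    (hU : ∀ i, MemLp (fun ω => U ω i) 2 P) (i : Fin c) :
    MemLp (fun ω => (A *ᵥ U ω) i) 2 P := by
  simp only [Matrix.mulVec, dotProduct]
  exact memLp_finsetSum _ fun l _ => (hU l).const_mul _

lemma crossMoment_mulVec_left (A : Matrix (Fin c) (Fin a) ℝ) {U : Ω → Fin a → ℝ}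
    {V : Ω → Fin b → ℝ} (hU : ∀ i, MemLp (fun ω => U ω i) 2 P)
    (hV : ∀ i, MemLp (fun ω => V ω i) 2 P) :
    crossMoment (fun ω => A *ᵥ U ω) V P = A * crossMoment U V P := by
  ext i j
  simp only [crossMoment, Matrix.of_apply, Matrix.mul_apply, Matrix.mulVec, dotProduct,
    Finset.sum_mul, mul_assoc]
  have hint : ∀ l, Integrable (fun ω => A i l * (U ω l * V ω j)) P := fun l =>
    ((hU l).integrable_mul (hV j)).const_mul _
  rw [integral_finsetSum _ fun l _ => hint l]
  simp only [integral_const_mul]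

lemma crossMoment_mulVec_right (A : Matrix (Fin c) (Fin b) ℝ) {U : Ω → Fin a → ℝ}
    {V : Ω → Fin b → ℝ} (hU : ∀ i, MemLp (fun ω => U ω i) 2 P)
    (hV : ∀ i, MemLp (fun ω => V ω i) 2 P) :
    crossMoment U (fun ω => A *ᵥ V ω) P = crossMoment U V P * Aᵀ := by
  rw [← transpose_crossMoment, crossMoment_mulVec_left A hV hU, Matrix.transpose_mul,
    transpose_crossMoment]

lemma dotProduct_crossMoment_mulVec {U : Ω → Fin a → ℝ}
    (hU : ∀ i, MemLp (fun ω => U ω i) 2 P) (v : Fin a → ℝ) :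
    v ⬝ᵥ (crossMoment U U P *ᵥ v) = ∫ ω, (v ⬝ᵥ U ω) ^ 2 ∂P := by
  -- The scalar `v ⬝ᵥ U` is treated as a vector of length one, so that bilinearity of `crossMoment`
  -- applies.
  have h1 : crossMoment (fun ω => Matrix.replicateRow (Fin 1) v *ᵥ U ω)
      (fun ω => Matrix.replicateRow (Fin 1) v *ᵥ U ω) P =
      Matrix.replicateRow (Fin 1) v * (crossMoment U U P * (Matrix.replicateRow (Fin 1) v)ᵀ) := by
    rw [crossMoment_mulVec_left _ hU (memLp_mulVec _ hU), crossMoment_mulVec_right _ hU hU]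
  have h2 := congrFun (congrFun h1 0) 0
  simp only [crossMoment, Matrix.of_apply, Matrix.mulVec, Matrix.replicateRow_apply, ← sq] at h2
  exact h2.symm

end Moments

/-! ### Measurability and independence of the iterates -/

section Iterates

variable {n d : ℕ}

lemma measurable_mulVec {a b : ℕ} (A : Matrix (Fin a) (Fin b) ℝ) :
    Measurable fun v : Fin b → ℝ => A *ᵥ v :=
  (Continuous.matrix_mulVec continuous_const continuous_id).measurable

lemma measurable_iterate (X : Matrix (Fin n) (Fin d) ℝ) (α : ℝ) {γ : Type*} [MeasurableSpace γ]
    {y : γ → Fin n → ℝ} {b₀ : γ → Fin d → ℝ} {δ : γ → ℕ → Fin d → ℝ} (hy : Measurable y)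
    (hb₀ : Measurable b₀) (hδ : ∀ k, Measurable fun x => δ x k) (k : ℕ) :
    Measurable fun x => iterate X α (y x) (b₀ x) (δ x) k := by
  induction k with
  | zero => exact hb₀
  | succ k ih =>
    have hdiag : ∀ {f : γ → Fin d → ℝ}, Measurable f →
        Measurable fun x => Matrix.diagonal (δ x k) *ᵥ f x := by
      intro f hf
      refine measurable_pi_iff.2 fun i => ?_
      simp only [Matrix.mulVec_diagonal]
      exact ((measurable_pi_apply i).comp (hδ k)).mul ((measurable_pi_apply i).comp hf)
    simp only [iterate]
    exact ih.add ((hdiag ((measurable_mulVec Xᵀ).comp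
      (hy.sub ((measurable_mulVec X).comp (hdiag ih))))).const_smul α)

lemma iterate_congr (X : Matrix (Fin n) (Fin d) ℝ) (α : ℝ) (y : Fin n → ℝ) (b₀ : Fin d → ℝ)
    {δ δ' : ℕ → Fin d → ℝ} {k : ℕ} (h : ∀ i < k, δ i = δ' i) :
    iterate X α y b₀ δ k = iterate X α y b₀ δ' k := by
  induction k with
  | zero => rfl
  | succ k ih => simp only [iterate, ih fun i hi => h i (hi.trans k.lt_succ_self), h k k.lt_succ_self]

/-- Both hypotheses together make the joint law of `((f, g), h)` the product of the three marginals,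
which is then reassociated. -/
lemma indepFun_prodMk_right_of_indepFun {Ω α β γ : Type*} [MeasurableSpace Ω] [MeasurableSpace α]
    [MeasurableSpace β] [MeasurableSpace γ] {P : Measure Ω} [IsProbabilityMeasure P]
    {f : Ω → α} {g : Ω → β} {h : Ω → γ} (hf : Measurable f) (hg : Measurable g)
    (hh : Measurable h) (hfg : IndepFun f g P) (hfgh : IndepFun (fun ω => (f ω, g ω)) h P) :
    IndepFun f (fun ω => (g ω, h ω)) P := by
  have hgh : IndepFun g h P := hfgh.comp measurable_snd measurable_id
  have := Measure.isProbabilityMeasure_map (μ := P) hf.aemeasurable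
  have := Measure.isProbabilityMeasure_map (μ := P) hg.aemeasurable
  have := Measure.isProbabilityMeasure_map (μ := P) hh.aemeasurable
  rw [indepFun_iff_map_prod_eq_prod_map_map hf.aemeasurable (hg.prodMk hh).aemeasurable,
    (indepFun_iff_map_prod_eq_prod_map_map hg.aemeasurable hh.aemeasurable).1 hgh,
    ← Measure.prodAssoc_prod, ← (indepFun_iff_map_prod_eq_prod_map_map hf.aemeasurable
      hg.aemeasurable).1 hfg, ← (indepFun_iff_map_prod_eq_prod_map_map
      (hf.prodMk hg).aemeasurable hh.aemeasurable).1 hfgh,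
    Measure.map_map MeasurableEquiv.prodAssoc.measurable ((hf.prodMk hg).prodMk hh)]
  rfl

lemma indepFun_iterate {Ω : Type*} [MeasurableSpace Ω] {P : Measure Ω} [IsProbabilityMeasure P]
    (X : Matrix (Fin n) (Fin d) ℝ) (α : ℝ) {Y : Ω → Fin n → ℝ} {β₀ : Ω → Fin d → ℝ}
    {δ : ℕ → Ω → Fin d → ℝ} (hY : Measurable Y) (hβ₀ : Measurable β₀)
    (hδ : ∀ k, Measurable (δ k)) (hδ_iindep : iIndepFun δ P)
    (hδ_indep : IndepFun (fun ω k => δ k ω) (fun ω => (β₀ ω, Y ω)) P) (k : ℕ) :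
    IndepFun (δ k) (fun ω => (iterate X α (Y ω) (β₀ ω) (fun i => δ i ω) k, Y ω)) P := by
  let past : Ω → Finset.range k → Fin d → ℝ := fun ω i => δ i ω
  have hpast : Measurable past := measurable_pi_iff.2 fun i => hδ i
  have h1 : IndepFun (δ k) past P :=
    (hδ_iindep.indepFun_finset {k} (Finset.range k) (by simp) hδ).comp
      (φ := fun x : ({k} : Finset ℕ) → Fin d → ℝ => x ⟨k, Finset.mem_singleton_self k⟩)
      (ψ := id) (measurable_pi_apply _) measurable_id
  have h2 : IndepFun (fun ω => (δ k ω, past ω)) (fun ω => (β₀ ω, Y ω)) P :=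
    hδ_indep.comp (φ := fun x : ℕ → Fin d → ℝ => (x k, fun i : Finset.range k => x i)) (ψ := id)
      (by fun_prop) measurable_id
  have h3 := indepFun_prodMk_right_of_indepFun (hδ k) hpast (hβ₀.prodMk hY) h1 h2
  -- The `k`-th iterate reads only the masks with index below `k`, so padding the past by zeros
  -- leaves it unchanged and exhibits it as a function of `(past, β₀, Y)`.
  let extend : (Finset.range k → Fin d → ℝ) → ℕ → Fin d → ℝ :=
    fun x i => if h : i ∈ Finset.range k then x ⟨i, h⟩ else 0
  have hextend : ∀ i, Measurable fun x => extend x i := by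
    intro i
    by_cases h : i ∈ Finset.range k
    · simp only [extend, dif_pos h]; exact measurable_pi_apply _
    · simp only [extend, dif_neg h]; exact measurable_const
  have h4 := h3.comp (φ := id)
    (ψ := fun z => (iterate X α z.2.2 z.2.1 (extend z.1) k, z.2.2)) measurable_id
    ((measurable_iterate X α (measurable_snd.comp measurable_snd)
      (measurable_fst.comp measurable_snd) (fun i => (hextend i).comp measurable_fst) k).prodMk
      (measurable_snd.comp measurable_snd))
  have heq : (fun ω => (iterate X α (Y ω) (β₀ ω) (fun i => δ i ω) k, Y ω)) =
      (fun z => (iterate X α z.2.2 z.2.1 (extend z.1) k, z.2.2)) ∘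
        fun ω => (past ω, β₀ ω, Y ω) := by
    funext ω
    refine Prod.ext (iterate_congr X α _ _ fun i hi => ?_) rfl
    simp [extend, past, hi]
  rw [heq]
  exact h4

/-- The normal equation trades `Xᵀ y` for `A_p b`, so the data enter the error recursion only
through `b`. -/
lemma iterate_succ_sub (X : Matrix (Fin n) (Fin d) ℝ) (α p : ℝ) {y : Fin n → ℝ}
    {b : Fin d → ℝ} (hb : shrink p (gram X) *ᵥ b = Xᵀ *ᵥ y) (b₀ : Fin d → ℝ)
    (δ : ℕ → Fin d → ℝ) (k : ℕ) :
    iterate X α y b₀ δ (k + 1) - b =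
      stepMatrix α (gram X) (δ k) *ᵥ (iterate X α y b₀ δ k - b) +
        noiseMatrix α p (gram X) (δ k) *ᵥ b := by
  have hgram : ∀ v, gram X *ᵥ v = Xᵀ *ᵥ (X *ᵥ v) := fun v => by
    rw [gram, Matrix.mulVec_mulVec]
  simp only [iterate, stepMatrix, noiseMatrix, Matrix.mulVec_sub, Matrix.sub_mulVec,
    Matrix.smul_mulVec, Matrix.one_mulVec, ← Matrix.mulVec_mulVec, hb, hgram, smul_sub]
  abel

end Iterates

/-! ### Recursions for the moments of the error -/

section Recursion

variable {Ω : Type*} [MeasurableSpace Ω] {P : Measure Ω} {d m : ℕ}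
  {α : ℝ} {p : unitInterval} {A : Matrix (Fin d) (Fin d) ℝ} {δ e b e' : Ω → Fin d → ℝ}
  {W : Ω → Fin m → ℝ}

lemma memLp_step_mask (he : ∀ i, MemLp (fun ω => e ω i) 2 P)
    (hb : ∀ i, MemLp (fun ω => b ω i) 2 P) (s : Finset (Fin d)) (i : Fin d) :
    MemLp (fun ω => (stepMatrix α A (mask s) *ᵥ e ω + noiseMatrix α p A (mask s) *ᵥ b ω) i)
      2 P :=
  (memLp_mulVec _ he i).add (memLp_mulVec _ hb i)

lemma measurable_step_mask (s : Finset (Fin d)) (i : Fin d) :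
    Measurable fun z : (Fin d → ℝ) × (Fin d → ℝ) =>
      (stepMatrix α A (mask s) *ᵥ z.1 + noiseMatrix α p A (mask s) *ᵥ z.2) i :=
  (measurable_pi_apply i).comp (((measurable_mulVec _).comp measurable_fst).add
    ((measurable_mulVec _).comp measurable_snd))

lemma memLp_step [IsProbabilityMeasure P] (hδ : Measurable δ) (hlaw : P.map δ = dropoutLaw d p)
    (hind : IndepFun δ (fun ω => (e ω, b ω)) P) (he : ∀ i, MemLp (fun ω => e ω i) 2 P)
    (hb : ∀ i, MemLp (fun ω => b ω i) 2 P) (he'_meas : Measurable e')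
    (he' : ∀ ω, e' ω = stepMatrix α A (δ ω) *ᵥ e ω + noiseMatrix α p A (δ ω) *ᵥ b ω)
    (i : Fin d) : MemLp (fun ω => e' ω i) 2 P := by
  have hmeas : Measurable fun ω => e' ω i := (measurable_pi_apply i).comp he'_meas
  rw [memLp_two_iff_integrable_sq hmeas.aestronglyMeasurable]
  have h := (integral_dropout hδ hlaw hind
    (fun x z => ((stepMatrix α A x *ᵥ z.1 + noiseMatrix α p A x *ᵥ z.2) i) ^ 2)
    (fun s => (measurable_step_mask s i).pow_const 2)
    (fun s => (memLp_step_mask he hb s i).integrable_sq)).1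
  simpa only [he'] using h

/-- Given `(e, b, W)` the noise term has mean zero, so only the mean of the step matrix survives.
Taking `W = b` yields the cross moment and `W = 1` the mean. -/
lemma crossMoment_step [IsProbabilityMeasure P] (hδ : Measurable δ) (hlaw : P.map δ = dropoutLaw d p)
    (hind : IndepFun δ (fun ω => ((e ω, b ω), W ω)) P) (he : ∀ i, MemLp (fun ω => e ω i) 2 P)
    (hb : ∀ i, MemLp (fun ω => b ω i) 2 P) (hW : ∀ i, MemLp (fun ω => W ω i) 2 P)
    (he' : ∀ ω, e' ω = stepMatrix α A (δ ω) *ᵥ e ω + noiseMatrix α p A (δ ω) *ᵥ b ω) :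
    crossMoment e' W P = (1 - (α * p) • shrink p A) * crossMoment e W P := by
  have h1 : crossMoment e' W P = ∑ s, weight p s •
      crossMoment (fun ω => stepMatrix α A (mask s) *ᵥ e ω +
        noiseMatrix α p A (mask s) *ᵥ b ω) W P := by
    ext i j
    have h := (integral_dropout hδ hlaw hind
      (fun x z => (stepMatrix α A x *ᵥ z.1.1 + noiseMatrix α p A x *ᵥ z.1.2) i * z.2 j)
      (fun s => ((measurable_step_mask s i).comp measurable_fst).mul
        ((measurable_pi_apply j).comp measurable_snd))
      (fun s => (memLp_step_mask he hb s i).integrable_mul (hW j))).2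
    simp only [Matrix.sum_apply, Matrix.smul_apply, smul_eq_mul, crossMoment, Matrix.of_apply, he']
    exact h
  have h2 : ∀ s, crossMoment (fun ω => stepMatrix α A (mask s) *ᵥ e ω +
      noiseMatrix α p A (mask s) *ᵥ b ω) W P =
      stepMatrix α A (mask s) * crossMoment e W P +
        noiseMatrix α p A (mask s) * crossMoment b W P := by
    intro s
    rw [crossMoment_add_left (memLp_mulVec _ he) (memLp_mulVec _ hb) hW,
      crossMoment_mulVec_left _ he hW, crossMoment_mulVec_left _ hb hW]
  simp only [h1, h2, smul_add, Finset.sum_add_distrib, ← Matrix.smul_mul]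
  rw [← Matrix.sum_mul, ← Matrix.sum_mul, sum_weight_smul_stepMatrix,
    sum_weight_smul_noiseMatrix, Matrix.zero_mul, add_zero]

/-- The mixed terms need not vanish, since the same mask drives the step and the noise matrix; but
they are linear in `𝔼[e bᵀ]`, which tends to zero along the iteration. -/
lemma crossMoment_self_step [IsProbabilityMeasure P] (hδ : Measurable δ) (hlaw : P.map δ = dropoutLaw d p)
    (hind : IndepFun δ (fun ω => (e ω, b ω)) P) (he : ∀ i, MemLp (fun ω => e ω i) 2 P)
    (hb : ∀ i, MemLp (fun ω => b ω i) 2 P)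
    (he' : ∀ ω, e' ω = stepMatrix α A (δ ω) *ᵥ e ω + noiseMatrix α p A (δ ω) *ᵥ b ω) :
    crossMoment e' e' P = stepAverage α p A (crossMoment e e P) + ∑ s, weight p s •
      (stepMatrix α A (mask s) * crossMoment e b P * (noiseMatrix α p A (mask s))ᵀ +
        noiseMatrix α p A (mask s) * (crossMoment e b P)ᵀ * (stepMatrix α A (mask s))ᵀ +
        noiseMatrix α p A (mask s) * crossMoment b b P * (noiseMatrix α p A (mask s))ᵀ) := by
  have h1 : crossMoment e' e' P = ∑ s, weight p s •
      crossMoment (fun ω => stepMatrix α A (mask s) *ᵥ e ω + noiseMatrix α p A (mask s) *ᵥ b ω)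
        (fun ω => stepMatrix α A (mask s) *ᵥ e ω + noiseMatrix α p A (mask s) *ᵥ b ω) P := by
    ext i j
    have h := (integral_dropout hδ hlaw hind
      (fun x z => (stepMatrix α A x *ᵥ z.1 + noiseMatrix α p A x *ᵥ z.2) i *
        (stepMatrix α A x *ᵥ z.1 + noiseMatrix α p A x *ᵥ z.2) j)
      (fun s => (measurable_step_mask s i).mul (measurable_step_mask s j))
      (fun s => (memLp_step_mask he hb s i).integrable_mul (memLp_step_mask he hb s j))).2
    simp only [Matrix.sum_apply, Matrix.smul_apply, smul_eq_mul, crossMoment, Matrix.of_apply, he']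
    exact h
  rw [h1, stepAverage_apply, ← Finset.sum_add_distrib]
  refine Finset.sum_congr rfl fun s _ => ?_
  rw [← smul_add]
  congr 1
  have hQ := memLp_mulVec (stepMatrix α A (mask s)) he
  have hR := memLp_mulVec (noiseMatrix α p A (mask s)) hb
  rw [crossMoment_add_left hQ hR (memLp_step_mask he hb s), crossMoment_add_right hQ hQ hR,
    crossMoment_add_right hR hQ hR, crossMoment_mulVec_left _ he hQ,
    crossMoment_mulVec_left _ he hR, crossMoment_mulVec_left _ hb hQ,
    crossMoment_mulVec_left _ hb hR, crossMoment_mulVec_right _ he he,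
    crossMoment_mulVec_right _ he hb, crossMoment_mulVec_right _ hb he,
    crossMoment_mulVec_right _ hb hb, transpose_crossMoment]
  simp only [Matrix.mul_assoc]
  abel

end Recursion

/-! ### The limiting covariance -/

section Limit

variable {Ω : Type*} [MeasurableSpace Ω] {P : Measure Ω} [IsProbabilityMeasure P] {n d : ℕ}

lemma isUnit_shrink {p : ℝ} {A : Matrix (Fin d) (Fin d) ℝ} (hA : Aᵀ = A)
    (hpos : 0 < lambdaMin (shrink p A)) : IsUnit (shrink p A) := by
  rw [← Matrix.mulVec_injective_iff_isUnit]
  intro v w hvw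
  have h := lambdaMin_mul_le (isHermitian_of_transpose (transpose_shrink p hA)) (v - w)
  have h0 : shrink p A *ᵥ (v - w) = 0 := by rw [Matrix.mulVec_sub, sub_eq_zero]; exact hvw
  rw [h0, dotProduct_zero] at h
  have h1 : (v - w) ⬝ᵥ (v - w) ≤ 0 := by
    by_contra hcon
    exact absurd h (not_le.2 (mul_pos hpos (not_le.1 hcon)))
  exact sub_eq_zero.1
    (dotProduct_self_eq_zero.1 (le_antisymm h1 (dotProduct_self_nonneg_real _)))

lemma crossMoment_eq_covMat {m : ℕ} {ε : Ω → Fin m → ℝ} (hε_sq : ∀ i, MemLp (fun ω => ε ω i) 2 P)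
    (hε_mean : ∀ i, ∫ ω, ε ω i ∂P = 0) : crossMoment ε ε P = covMat ε P := by
  ext i j
  simp only [crossMoment, covMat, Matrix.of_apply]
  rw [covariance_eq_sub (hε_sq i) (hε_sq j), hε_mean, zero_mul, sub_zero]
  rfl

/-- The second moment of a linear statistic in a linear model with isotropic noise. -/
lemma le_integral_sq_linear {ε : Ω → Fin n → ℝ} (hε_sq : ∀ i, MemLp (fun ω => ε ω i) 2 P)
    (hε_mean : ∀ i, ∫ ω, ε ω i ∂P = 0) (hε_cov : covMat ε P = 1) (u m : Fin n → ℝ) :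
    u ⬝ᵥ u ≤ ∫ ω, (u ⬝ᵥ (m + ε ω)) ^ 2 ∂P := by
  have hlp : MemLp (fun ω => u ⬝ᵥ ε ω) 2 P := by
    simp only [dotProduct]
    exact memLp_finsetSum _ fun l _ => (hε_sq l).const_mul _
  have hmean : ∫ ω, u ⬝ᵥ ε ω ∂P = 0 := by
    simp only [dotProduct]
    rw [integral_finsetSum _ fun l _ => ((hε_sq l).integrable (by norm_num)).const_mul _]
    simp [integral_const_mul, hε_mean]
  have hint1 : Integrable (fun ω => u ⬝ᵥ ε ω) P := hlp.integrable (by norm_num)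
  have hsq : ∫ ω, (u ⬝ᵥ ε ω) ^ 2 ∂P = u ⬝ᵥ u := by
    rw [← dotProduct_crossMoment_mulVec hε_sq, crossMoment_eq_covMat hε_sq hε_mean, hε_cov,
      Matrix.one_mulVec]
  have hexp : ∀ ω, (u ⬝ᵥ (m + ε ω)) ^ 2 =
      ((u ⬝ᵥ m) ^ 2 + 2 * (u ⬝ᵥ m) * (u ⬝ᵥ ε ω)) + (u ⬝ᵥ ε ω) ^ 2 := by
    intro ω
    rw [dotProduct_add]; ring
  have hint2 : Integrable (fun ω => (u ⬝ᵥ m) ^ 2 + 2 * (u ⬝ᵥ m) * (u ⬝ᵥ ε ω)) P :=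
    (integrable_const _).add (hint1.const_mul _)
  simp only [hexp]
  rw [integral_add hint2 hlp.integrable_sq, integral_add (integrable_const _) (hint1.const_mul _), integral_const_mul, hmean, hsq]
  simp only [integral_const, probReal_univ, one_smul, mul_zero, add_zero]
  exact le_add_of_nonneg_left (sq_nonneg _)

/-- A lower bound for the second moment matrix of the minimizer of the marginalized loss. -/
lemma le_crossMoment_minimizer (X : Matrix (Fin n) (Fin d) ℝ) {p : unitInterval}
    (hpos : 0 < lambdaMin (shrink p (gram X))) (hN : 0 < spectralNorm (gram X))
    {ε : Ω → Fin n → ℝ} (hε_sq : ∀ i, MemLp (fun ω => ε ω i) 2 P)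
    (hε_mean : ∀ i, ∫ ω, ε ω i ∂P = 0) (hε_cov : covMat ε P = 1) (m : Fin n → ℝ)
    {b : Ω → Fin d → ℝ} (hb_sq : ∀ i, MemLp (fun ω => b ω i) 2 P)
    (hb : ∀ ω, b ω = ((shrink p (gram X))⁻¹ * Xᵀ) *ᵥ (m + ε ω)) (v : Fin d → ℝ) :
    lambdaMin (gram X) / spectralNorm (gram X) ^ 2 * (v ⬝ᵥ v) ≤
      v ⬝ᵥ (crossMoment b b P *ᵥ v) := by
  have hunit := isUnit_shrink (transpose_gram X) hpos
  have hdet := (Matrix.isUnit_iff_isUnit_det _).1 hunit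
  -- With `v = A_p z`, `v ⬝ᵥ b = (X z) ⬝ᵥ Y` has second moment at least `|X z|² ≥ λ_min(A) |z|²`,
  -- while `|v| ≤ ‖A‖ |z|`.
  set z := (shrink p (gram X))⁻¹ *ᵥ v
  have hz : shrink p (gram X) *ᵥ z = v := by
    rw [Matrix.mulVec_mulVec, Matrix.mul_nonsing_inv _ hdet, Matrix.one_mulVec]
  have hdot : ∀ ω, v ⬝ᵥ b ω = (X *ᵥ z) ⬝ᵥ (m + ε ω) := by
    intro ω
    rw [hb, Matrix.dotProduct_mulVec, ← Matrix.mulVec_transpose, Matrix.transpose_mul,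
      Matrix.transpose_transpose, Matrix.transpose_nonsing_inv,
      transpose_shrink _ (transpose_gram X), ← Matrix.mulVec_mulVec]
  rw [dotProduct_crossMoment_mulVec hb_sq]
  simp only [hdot]
  refine le_trans ?_ (le_integral_sq_linear hε_sq hε_mean hε_cov _ m)
  have h1 : (X *ᵥ z) ⬝ᵥ (X *ᵥ z) = z ⬝ᵥ (gram X *ᵥ z) := by
    rw [gram, ← Matrix.mulVec_mulVec, Matrix.dotProduct_mulVec z, Matrix.vecMul_transpose]
  have h2 := lambdaMin_mul_le (posSemidef_gram X).isHermitian z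
  have h3 : v ⬝ᵥ v ≤ spectralNorm (gram X) ^ 2 * (z ⬝ᵥ z) := by
    rw [← norm_toLp_sq, ← norm_toLp_sq, ← mul_pow, ← hz]
    gcongr
    exact norm_toLp_shrink_mulVec_le (posSemidef_gram X) p.2.1 p.2.2 z
  rw [h1]
  refine le_trans ?_ h2
  rw [div_mul_eq_mul_div, div_le_iff₀ (by positivity)]
  have := mul_le_mul_of_nonneg_left h3 (lambdaMin_nonneg (posSemidef_gram X))
  linarith

lemma tendsto_covMat_add {e : ℕ → Ω → Fin d → ℝ} {b : Ω → Fin d → ℝ}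
    {M : Matrix (Fin d) (Fin d) ℝ} (he : ∀ k i, MemLp (fun ω => e k ω i) 2 P)
    (hb : ∀ i, MemLp (fun ω => b ω i) 2 P)
    (hM : Tendsto (fun k => crossMoment (e k) (e k) P) atTop (𝓝 M))
    (hC : Tendsto (fun k => crossMoment (e k) b P) atTop (𝓝 0))
    (hm : Tendsto (fun k => crossMoment (e k) (fun _ _ => 1 : Ω → Fin 1 → ℝ) P) atTop (𝓝 0)) :
    Tendsto (fun k => covMat (fun ω => e k ω + b ω) P) atTop (𝓝 (M + covMat b P)) := by
  have hM' : ∀ i j, Tendsto (fun k => ∫ ω, e k ω i * e k ω j ∂P) atTop (𝓝 (M i j)) := fun i j =>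
    tendsto_pi_nhds.1 (tendsto_pi_nhds.1 hM i) j
  have hC' : ∀ i j, Tendsto (fun k => ∫ ω, e k ω i * b ω j ∂P) atTop (𝓝 0) := fun i j =>
    tendsto_pi_nhds.1 (tendsto_pi_nhds.1 hC i) j
  have hm' : ∀ i, Tendsto (fun k => ∫ ω, e k ω i ∂P) atTop (𝓝 0) := fun i => by
    simpa [crossMoment] using tendsto_pi_nhds.1 (tendsto_pi_nhds.1 hm i) 0
  have hcovC : ∀ i j, Tendsto (fun k => covariance (fun ω => e k ω i) (fun ω => b ω j) P)
      atTop (𝓝 0) := by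
    intro i j
    have h : ∀ k, covariance (fun ω => e k ω i) (fun ω => b ω j) P =
        ∫ ω, e k ω i * b ω j ∂P - (∫ ω, e k ω i ∂P) * ∫ ω, b ω j ∂P := fun k =>
      covariance_eq_sub (he k i) (hb j)
    simp only [h]
    simpa using (hC' i j).sub ((hm' i).mul_const _)
  refine tendsto_pi_nhds.2 fun i => tendsto_pi_nhds.2 fun j => ?_
  have hexp : ∀ k, covMat (fun ω => e k ω + b ω) P i j =
      (∫ ω, e k ω i * e k ω j ∂P - (∫ ω, e k ω i ∂P) * ∫ ω, e k ω j ∂P) +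
      covariance (fun ω => e k ω i) (fun ω => b ω j) P +
      (covariance (fun ω => e k ω j) (fun ω => b ω i) P + covMat b P i j) := by
    intro k
    have h1 : covMat (fun ω => e k ω + b ω) P i j =
        covariance ((fun ω => e k ω i) + fun ω => b ω i)
          ((fun ω => e k ω j) + fun ω => b ω j) P := rfl
    have h2 : covariance (fun ω => e k ω i) (fun ω => e k ω j) P =
        ∫ ω, e k ω i * e k ω j ∂P - (∫ ω, e k ω i ∂P) * ∫ ω, e k ω j ∂P :=
      covariance_eq_sub (he k i) (he k j)
    rw [h1, covariance_add_left (he k i) (hb i) ((he k j).add (hb j)),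
      covariance_add_right (he k i) (he k j) (hb j), covariance_add_right (hb i) (he k j) (hb j),
      h2, covariance_comm (fun ω => b ω i) (fun ω => e k ω j)]
    rfl
  simp only [hexp]
  have := (((hM' i j).sub ((hm' i).mul (hm' j))).add (hcovC i j)).add
    ((hcovC j i).add_const (covMat b P i j))
  simpa using this

/-- The covariance of a square integrable solution of the error recursion, shifted by the
minimizer of the marginalized loss, converges, and the limit solves a stationary second moment
equation. -/
lemma exists_tendsto_covMat {α : ℝ} {p : unitInterval} {A : Matrix (Fin d) (Fin d) ℝ}
    (hAt : Aᵀ = A) {r : ℝ} (hr0 : 0 ≤ r) (hr1 : r < 1)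
    (hcontr : ∀ v, ∑ s, weight p s *
      ((stepMatrix α A (mask s) *ᵥ v) ⬝ᵥ (stepMatrix α A (mask s) *ᵥ v)) ≤ r ^ 2 * (v ⬝ᵥ v))
    {δ e : ℕ → Ω → Fin d → ℝ} {b : Ω → Fin d → ℝ} (hδ_meas : ∀ k, Measurable (δ k))
    (hδ_law : ∀ k, P.map (δ k) = dropoutLaw d p)
    (hind_error : ∀ k, IndepFun (δ k) (fun ω => (e k ω, b ω)) P)
    (he0_sq : ∀ i, MemLp (fun ω => e 0 ω i) 2 P) (hb_sq : ∀ i, MemLp (fun ω => b ω i) 2 P)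
    (he_meas : ∀ k, Measurable (e k))
    (he_step : ∀ k ω, e (k + 1) ω =
      stepMatrix α A (δ k ω) *ᵥ e k ω + noiseMatrix α p A (δ k ω) *ᵥ b ω) :
    ∃ M : Matrix (Fin d) (Fin d) ℝ, Mᵀ = M ∧ (∀ v, 0 ≤ v ⬝ᵥ (M *ᵥ v)) ∧
      M = stepAverage α p A M + ∑ s, weight p s • (noiseMatrix α p A (mask s) *
        crossMoment b b P * (noiseMatrix α p A (mask s))ᵀ) ∧
      Tendsto (fun k => covMat (fun ω => e k ω + b ω) P) atTop (𝓝 (M + covMat b P)) := by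
  have he_sq : ∀ k i, MemLp (fun ω => e k ω i) 2 P := by
    intro k
    induction k with
    | zero => exact he0_sq
    | succ k ih =>
      exact memLp_step (hδ_meas k) (hδ_law k) (hind_error k) ih hb_sq (he_meas (k + 1)) (he_step k)
  set G := 1 - (α * p) • shrink p A
  have hG : Tendsto (fun k => G ^ k) atTop (𝓝 0) :=
    tendsto_pow_of_spectralNorm_lt_one ((spectralNorm_one_sub_shrink_le hr0 hcontr).trans_lt hr1)
  have hcross : ∀ {m : ℕ} (W : Ω → Fin m → ℝ), (∀ i, MemLp (fun ω => W ω i) 2 P) →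
      (∀ k, IndepFun (δ k) (fun ω => ((e k ω, b ω), W ω)) P) →
      Tendsto (fun k => crossMoment (e k) W P) atTop (𝓝 0) := by
    intro m W hW hWind
    have h : ∀ k, crossMoment (e k) W P = G ^ k * crossMoment (e 0) W P := by
      intro k
      induction k with
      | zero => simp
      | succ k ih =>
        rw [crossMoment_step (hδ_meas k) (hδ_law k) (hWind k) (he_sq k) hb_sq hW (he_step k), ih,
          ← Matrix.mul_assoc, ← pow_succ']
    rw [funext h]
    have hcont : Continuous fun B : Matrix (Fin d) (Fin d) ℝ => B * crossMoment (e 0) W P :=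
      continuous_id.matrix_mul continuous_const
    have hlim := (hcont.tendsto 0).comp hG
    rwa [Matrix.zero_mul] at hlim
  have hC := hcross b hb_sq fun k =>
    (hind_error k).comp (φ := id) (ψ := fun z : (Fin d → ℝ) × (Fin d → ℝ) => (z, z.2)) measurable_id
      (measurable_id.prodMk measurable_snd)
  have hmean := hcross (m := 1) (fun _ _ => 1) (fun _ => memLp_const _) fun k =>
    (hind_error k).comp (φ := id) (ψ := fun z : (Fin d → ℝ) × (Fin d → ℝ) => (z, fun _ => 1)) measurable_id
      (measurable_id.prodMk measurable_const)
  set S := crossMoment b b P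
  -- The forcing of the second moment recursion as a function of `C = 𝔼[e bᵀ]`; by continuity its
  -- limit is the value at `C = 0`, the pure noise term.
  let f : Matrix (Fin d) (Fin d) ℝ → Matrix (Fin d) (Fin d) ℝ := fun C => ∑ s, weight p s •
      (stepMatrix α A (mask s) * C * (noiseMatrix α p A (mask s))ᵀ +
        noiseMatrix α p A (mask s) * Cᵀ * (stepMatrix α A (mask s))ᵀ +
        noiseMatrix α p A (mask s) * S * (noiseMatrix α p A (mask s))ᵀ)
  have hfcont : Continuous f := by fun_prop
  obtain ⟨M, hMfix, hM⟩ := exists_fixedPoint_tendsto_matrix (stepAverage α p A)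
    (x := fun k => crossMoment (e k) (e k) P)
    (mul_nonneg hr0 hr0) (mul_lt_one_of_nonneg_of_lt_one_left hr0 hr1 hr1.le)
    (spectralNorm_stepAverage_le hAt hr0 hcontr) ((hfcont.tendsto 0).comp hC)
    (fun k => crossMoment_self_step (hδ_meas k) (hδ_law k) (hind_error k) (he_sq k) hb_sq (he_step k))
  have hMt : Mᵀ = M := by
    refine tendsto_nhds_unique ((continuous_id.matrix_transpose.tendsto M).comp hM) ?_
    simpa only [Function.comp_def, id, transpose_crossMoment] using hM
  have hMpos : ∀ v, 0 ≤ v ⬝ᵥ (M *ᵥ v) := by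
    intro v
    have hcont : Continuous fun B : Matrix (Fin d) (Fin d) ℝ => v ⬝ᵥ (B *ᵥ v) := by fun_prop
    refine ge_of_tendsto' ((hcont.tendsto M).comp hM) fun k => ?_
    simp only [Function.comp]
    rw [dotProduct_crossMoment_mulVec (he_sq k)]
    exact integral_nonneg fun ω => sq_nonneg _
  exact ⟨M, hMt, hMpos, by simpa [f] using hMfix, tendsto_covMat_add he_sq hb_sq hM hC hmean⟩

end Limit

end

end Dropout

theorem mainTheorem2 {Ω : Type*} [MeasurableSpace Ω] (P : Measure Ω) [IsProbabilityMeasure P]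
    {n d : ℕ} (X : Matrix (Fin n) (Fin d) ℝ)
    -- the linear regression model `Y = X β⋆ + ε`
    (βstar : Fin d → ℝ) (ε Y : Ω → Fin n → ℝ)
    (hε_meas : Measurable ε)
    (hε_sq : ∀ i, MemLp (fun ω => ε ω i) 2 P)
    (hε_mean : ∀ i, ∫ ω, ε ω i ∂P = 0)
    (hε_cov : Dropout.covMat ε P = 1)
    (hY : ∀ ω, Y ω = X *ᵥ βstar + ε ω)
    -- the model is in reduced form: `X` has no zero column
    (hX : ∀ j, ∃ i, X i j ≠ 0)
    -- the square integrable initialization, independent of the data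
    (β₀ : Ω → Fin d → ℝ)
    (hβ₀_meas : Measurable β₀)
    (hβ₀_sq : ∀ j, MemLp (fun ω => β₀ ω j) 2 P)
    (hβ₀_indep : IndepFun β₀ Y P)
    -- i.i.d. `p`-dropout matrices `D₁, D₂, …`, given by their diagonals `δ 0, δ 1, …` and
    -- independent of the initialization and the data
    (p : unitInterval) (hp0 : 0 < p) (hp1 : p < 1)
    (δ : ℕ → Ω → Fin d → ℝ)
    (hδ_meas : ∀ k, Measurable (δ k))
    (hδ_law : ∀ k, P.map (δ k) = Dropout.dropoutLaw d p)
    (hδ_iindep : iIndepFun δ P)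
    (hδ_indep : IndepFun (fun ω k => δ k ω) (fun ω => (β₀ ω, Y ω)) P)
    -- the learning rate
    (α : ℝ) (hα : 0 < α)
    (hα1 : α * p * Dropout.spectralNorm (Dropout.gram X) < 1)
    (hα2 : α < Dropout.lambdaMin (Dropout.shrink p (Dropout.gram X)) /
      (3 * Dropout.spectralNorm (Dropout.gram X) ^ 2))
    -- every row of the Gram matrix has a nonzero off-diagonal entry
    (hoff : ∀ l, ∃ m, m ≠ l ∧ Dropout.gram X l m ≠ 0) :
    ∃ L : Matrix (Fin d) (Fin d) ℝ,
      Tendsto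
        (fun k => Dropout.covMat
          (fun ω => Dropout.iterate X α (Y ω) (β₀ ω) (fun i => δ i ω) k) P)
        atTop (𝓝 L) ∧
      ((L - Dropout.covMat (fun ω => Dropout.marginalMinimizer X p (Y ω)) P) -
        ((α * p * (1 - p) ^ 2 * Dropout.lambdaMin (Dropout.gram X)) /
            (2 * Dropout.spectralNorm (Dropout.gram X) ^ 3) *
          Dropout.minOffDiagSq (Dropout.gram X)) •
          (1 : Matrix (Fin d) (Fin d) ℝ)).PosSemidef := by
  open Dropout in
  have hp : (0 : ℝ) < p := hp0
  set A := gram X with hAdef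
  have hAt : Aᵀ = A := transpose_gram X
  have hApsd : A.PosSemidef := posSemidef_gram X
  have hm0 := minOffDiagSq_nonneg A
  have hlam0 := lambdaMin_nonneg hApsd
  set N := spectralNorm A with hNdef
  have hN : 0 < N := by
    -- If `‖A‖ = 0`, division by zero turns the learning rate bound into `α < 0`.
    refine (spectralNorm_nonneg A).lt_of_ne fun h => ?_
    rw [← hNdef] at h
    rw [← h] at hα2
    norm_num at hα2
    exact absurd hα (not_lt.2 hα2.le)
  have hα2' : α * (3 * N ^ 2) < lambdaMin (shrink p A) := (lt_div_iff₀ (by positivity)).1 hα2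
  have hpos : 0 < lambdaMin (shrink p A) := lt_trans (by positivity) hα2'
  -- the rate of contraction
  set ρ := 1 - α * p * (2 * lambdaMin (shrink p A) - α * N ^ 2)
  have hρ1 : ρ < 1 := by
    have : 0 < 2 * lambdaMin (shrink p A) - α * N ^ 2 := by
      have : 0 < α * N ^ 2 := by positivity
      linarith
    have := mul_pos (mul_pos hα hp) this
    simp only [ρ]
    linarith
  -- Truncating at zero makes `r ^ 2` an upper bound for `ρ` without a proof that `ρ ≥ 0`.
  set r := √(max ρ 0)
  have hr0 : 0 ≤ r := Real.sqrt_nonneg _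
  have hrsq : r ^ 2 = max ρ 0 := Real.sq_sqrt (le_max_right _ _)
  have hr1 : r < 1 := by
    rw [← Real.sqrt_one]
    exact Real.sqrt_lt_sqrt (le_max_right _ _) (max_lt hρ1 one_pos)
  have hcontr : ∀ v, ∑ s, weight p s *
      ((stepMatrix α A (mask s) *ᵥ v) ⬝ᵥ (stepMatrix α A (mask s) *ᵥ v)) ≤
        r ^ 2 * (v ⬝ᵥ v) := fun v => by
    rw [hrsq]
    exact (sum_weight_mul_stepMatrix_le hα.le p hAt v).trans
      (mul_le_mul_of_nonneg_right (le_max_left _ _) (dotProduct_self_nonneg_real v))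
  -- the minimizer of the marginalized loss
  have hdet := (Matrix.isUnit_iff_isUnit_det _).1 (isUnit_shrink hAt hpos)
  set K := (shrink p A)⁻¹ * Xᵀ
  have hK : ∀ y, shrink p A *ᵥ (K *ᵥ y) = Xᵀ *ᵥ y := fun y => by
    rw [Matrix.mulVec_mulVec, ← Matrix.mul_assoc, Matrix.mul_nonsing_inv _ hdet, Matrix.one_mul]
  have hmin : ∀ y, marginalMinimizer X p y = K *ᵥ y := fun y =>
    marginalMinimizer_eq X p hp0 hpos (hK y)
  simp only [hmin]
  set b : Ω → Fin d → ℝ := fun ω => K *ᵥ Y ω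
  have hYm : Measurable Y := by
    rw [funext hY]
    exact measurable_const.add hε_meas
  have hY_sq : ∀ i, MemLp (fun ω => Y ω i) 2 P := fun i => by
    simp only [hY, Pi.add_apply]
    exact (memLp_const ((X *ᵥ βstar) i)).add (hε_sq i)
  have hb_sq : ∀ i, MemLp (fun ω => b ω i) 2 P := memLp_mulVec K hY_sq
  -- the error and its moments
  set e : ℕ → Ω → Fin d → ℝ := fun k ω =>
    iterate X α (Y ω) (β₀ ω) (fun i => δ i ω) k - b ω with hedef
  have he_meas : ∀ k, Measurable (e k) := fun k =>
    (measurable_iterate X α hYm hβ₀_meas hδ_meas k).sub ((measurable_mulVec K).comp hYm)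
  have he_step : ∀ k ω, e (k + 1) ω =
      stepMatrix α A (δ k ω) *ᵥ e k ω + noiseMatrix α p A (δ k ω) *ᵥ b ω := fun k ω =>
    iterate_succ_sub X α p (hK (Y ω)) _ _ k
  have hindep := indepFun_iterate X α hYm hβ₀_meas hδ_meas hδ_iindep hδ_indep
  have hind_error : ∀ k, IndepFun (δ k) (fun ω => (e k ω, b ω)) P := fun k =>
    (hindep k).comp (φ := id)
      (ψ := fun z : (Fin d → ℝ) × (Fin n → ℝ) => (z.1 - K *ᵥ z.2, K *ᵥ z.2)) measurable_id
      ((measurable_fst.sub ((measurable_mulVec K).comp measurable_snd)).prodMk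
        ((measurable_mulVec K).comp measurable_snd))
  obtain ⟨M, hMt, hMpos, hMfix, hM⟩ := exists_tendsto_covMat hAt hr0 hr1 hcontr hδ_meas hδ_law
    hind_error (fun i => (hβ₀_sq i).sub (hb_sq i)) hb_sq he_meas he_step
  -- `σ` is the lower bound for `𝔼[b bᵀ]`, and `c` is `σ α² p² (1 - p)² min A_ij²` divided by `2 α p
  -- ‖A‖`, which is the constant of the theorem.
  have hlow := le_dotProduct_mulVec_of_fixedPoint hα hApsd hAt hoff (by positivity) hα1 hMpos
    (σ := lambdaMin A / N ^ 2)
    (c := α * p * (1 - p) ^ 2 * lambdaMin A / (2 * N ^ 3) * minOffDiagSq A)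
    (by positivity)
    (le_crossMoment_minimizer X hpos hN hε_sq hε_mean hε_cov (X *ᵥ βstar) hb_sq
      fun ω => by rw [← hY])
    (hMfix) (by positivity) (by rw [← hNdef]; field_simp)
  refine ⟨M + covMat b P, ?_, ?_⟩
  · simpa only [hedef, sub_add_cancel] using hM
  · rw [add_sub_cancel_right]
    refine Matrix.PosSemidef.of_dotProduct_mulVec_nonneg ?_ fun v => ?_
    · exact isHermitian_of_transpose (by simp [hMt])
    · have := hlow v
      rw [star_trivial, Matrix.sub_mulVec, Matrix.smul_mulVec, Matrix.one_mulVec, dotProduct_sub,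
        dotProduct_smul, smul_eq_mul]
      linarith
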